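/- Let $G=(V,E)$ be a simple undirected graph and $R$ a commutative ring with unit. A graph map between graphs sends the two ends of every edge either to the same vertex or to the two ends of an edge. *Cubical homology.* Let $Q_n$ be the graph on $\{0,1\}^n$ whose edges join vectors at Hamming distance $1$, and let $\mathcal L_n$ be the free $R$-module on all graph maps $\sigma:Q_n\to G$. Let $f_i^{+}\sigma$ and $f_i^-\sigma$ be the restrictions of $\sigma$ to the faces on which the $i$-th coordinate is $1$ and $0$. Then $\mathcal H^{\mathrm{Cube}}_n(G;R)$ is the homology $\ker\partial_n/\operatorname{im}\partial_{n+1}$ of the complex $\mathcal L_n/\mathcal D_n$, where $\mathcal D_n$ is generated by the $\sigma$ with $f_i^+\sigma=f_i^-\sigma$ for some $i$, and $\partial_n\sigma=\sum_{i=1}^n(-1)^i(f_i^-\sigma-f_i^+\sigma)$ (with $\partial_0=0$). *Path homology.* Let $\mathcal C_n(V)$ be the free $R$-module on all tuples $(v_0,\dots,v_n)\in V^{n+1}$ modulo the tuples with $v_i=v_{i+1}$ for some $i$, with boundary $\partial_n(v_0,\dots,v_n)=\sum_{i=0}^n(-1)^i(v_0,\dots,\widehat{v_i},\dots,v_n)$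 (with $\partial_0=0$). Let $\widetilde{\mathcal C}_n(G)\subseteq\mathcal C_n(V)$ be spanned by the tuples with $\{v_i,v_{i+1}\}\in E$ for all $i<n$ (and $\widetilde{\mathcal C}_{-1}(G)=0$). Then $\mathcal H^{\mathrm{Path}}_n(G;R)$ is the homology of the complex $\mathcal C_n(G)=\{x\in\widetilde{\mathcal C}_n(G):\partial_n x\in\widetilde{\mathcal C}_{n-1}(G)\}$. *Discrete fundamental group.* For $v_0\in V$, let $A_1(G,v_0)$ be the group, under concatenation, of homotopy classes of graph maps $f:\mathbb Z\to G$ with $f(i)=v_0$ for all but finitely many $i$, where $\mathbb Z$ is the two-way infinite path. Here $f$ and $g$ are homotopic if for some $m\ge 0$ there is a graph map $\Phi:\mathbb Z\,\Box\,I_m\to G$, where $I_m$ is the path on $\{0,\dots,m\}$ and $\Box$ is the Cartesian product of graphs, such that $\Phi(\cdot,0)=f$, $\Phi(\cdot,m)=g$, and $\Phi(i,j)=v_0$ for all $j$ and all but finitely many $i$. **Corollary.** (1) $\mathcal H_1^{\mathrm{Cube}}(G;R)\cong\mathcal H_1^{\mathrm{Path}}(G;R)$ as $R$-modules. (2) If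 $G$ is connected, then for every $v_0\in V$, with $A=A_1(G,v_0)$, there are isomorphisms of abelian groups $$\mathcal H_1^{\mathrm{Cube}}(G;\mathbb Z)\;\cong\;A/[A,A]\;\cong\;\mathcal H_1^{\mathrm{Path}}(G;\mathbb Z),$$ and, for coefficients in $R$, isomorphisms of $R$-modules $$\mathcal H_1^{\mathrm{Cube}}(G;R)\;\cong\;R\otimes_{\mathbb Z}A/[A,A]\;\cong\;\mathcal H_1^{\mathrm{Path}}(G;R).$$ -/

import Mathlib

open scoped TensorProduct

namespace DiscreteHomology

/-- The notion of graph homomorphism in discrete homotopy theory: the two ends of an edge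
are sent either to one vertex or to the two ends of an edge. -/
@[ext]
structure GraphMap {V W : Type*} (G : SimpleGraph V) (H : SimpleGraph W) where
  toFun : V → W
  map_adj : ∀ a b, G.Adj a b → toFun a = toFun b ∨ H.Adj (toFun a) (toFun b)

instance {V W : Type*} (G : SimpleGraph V) (H : SimpleGraph W) :
    CoeFun (GraphMap G H) (fun _ => V → W) := ⟨GraphMap.toFun⟩

/-! ### Cubical homology -/

/-- The discrete `n`-cube: vertices are 0-1-vectors of length `n` (`true` stands for 1),
edges join vectors at Hamming distance one. -/
def cubeGraph (n : ℕ) : SimpleGraph (Fin n → Bool) where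
  Adj a b := hammingDist a b = 1
  symm := ⟨fun _ _ h => by rw [hammingDist_comm]; exact h⟩
  loopless := ⟨fun a h => by simp at h⟩

/-- Singular `n`-cubes on `G`. -/
abbrev SingularCube {V : Type*} (G : SimpleGraph V) (n : ℕ) := GraphMap (cubeGraph n) G

theorem cubeGraph_adj_insertNth {n : ℕ} (i : Fin (n + 1)) (e : Bool) {a b : Fin n → Bool}
    (h : (cubeGraph n).Adj a b) :
    (cubeGraph (n + 1)).Adj (i.insertNth (α := fun _ => Bool) e a)
      (i.insertNth (α := fun _ => Bool) e b) := by
  change hammingDist _ _ = 1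
  refine Eq.trans ?_ (h : hammingDist a b = 1)
  unfold hammingDist
  rw [Finset.card_filter, Finset.card_filter, Fin.sum_univ_succAbove _ i]
  simp

/-- The `i`-th face of a singular cube: `e = true` is the front face `f_i^+`,
`e = false` is the back face `f_i^-`. -/
def face {V : Type*} {G : SimpleGraph V} {n : ℕ} (e : Bool) (i : Fin (n + 1))
    (σ : SingularCube G (n + 1)) : SingularCube G n where
  toFun a := σ (i.insertNth (α := fun _ => Bool) e a)
  map_adj _ _ h := σ.map_adj _ _ (cubeGraph_adj_insertNth i e h)

/-- A singular cube of positive dimension is degenerate if two opposite faces agree. -/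
def IsDegenerateCube {V : Type*} {G : SimpleGraph V} : {n : ℕ} → SingularCube G n → Prop
  | 0, _ => False
  | _ + 1, σ => ∃ i, face true i σ = face false i σ

/-- The submodule `D_n` generated by the degenerate cubes in the free module `L_n` on all
singular `n`-cubes. -/
noncomputable def cubeDegenerate (R : Type*) [CommRing R] {V : Type*} (G : SimpleGraph V) (n : ℕ) :
    Submodule R (SingularCube G n →₀ R) :=
  Submodule.span R {x | ∃ σ : SingularCube G n, IsDegenerateCube σ ∧ x = Finsupp.single σ 1}

/-- The boundary `∂ σ = ∑ (-1)^i (f_i^- σ - f_i^+ σ)` on `L_{n+1}`. The coordinates are numbered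
from `0` here, hence the exponent `i + 1`. -/
noncomputable def cubeFreeBoundary (R : Type*) [CommRing R] {V : Type*} (G : SimpleGraph V)
    (n : ℕ) : (SingularCube G (n + 1) →₀ R) →ₗ[R] (SingularCube G n →₀ R) :=
  Finsupp.linearCombination R fun σ => ∑ i : Fin (n + 1),
    (-1 : R) ^ ((i : ℕ) + 1) •
      (Finsupp.single (face false i σ) (1 : R) - Finsupp.single (face true i σ) (1 : R))

theorem isDegenerateCube_face {V : Type*} {G : SimpleGraph V} {n : ℕ}
    {σ : SingularCube G (n + 1)} {i : Fin (n + 1)} (h : face true i σ = face false i σ)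
    (e : Bool) {j : Fin (n + 1)} (hj : i ≠ j) : IsDegenerateCube (face e j σ) := by
  have key : ∀ a : Fin (n + 1) → Bool,
      σ (Function.update a i true) = σ (Function.update a i false) := by
    intro a
    have := congrArg (fun τ : SingularCube G n => τ (i.removeNth a)) h
    simpa [face, Fin.insertNth_removeNth] using this
  obtain ⟨k, rfl⟩ := Fin.exists_succAbove_eq hj
  cases n with
  | zero => exact k.elim0
  | succ n =>
    refine ⟨k, ?_⟩
    ext a
    have hu : ∀ x : Bool, j.insertNth (α := fun _ => Bool) e
        (k.insertNth (α := fun _ => Bool) x a) =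
        Function.update (j.insertNth (α := fun _ => Bool) e
          (k.insertNth (α := fun _ => Bool) false a)) (j.succAbove k) x := by
      intro x
      ext l
      rcases Fin.eq_self_or_eq_succAbove j l with rfl | ⟨l, rfl⟩
      · rw [Function.update_of_ne (Fin.succAbove_ne _ _).symm]; simp
      · rcases Fin.eq_self_or_eq_succAbove k l with rfl | ⟨l, rfl⟩
        · simp
        · rw [Function.update_of_ne]
          · simp
          · intro hh
            exact Fin.succAbove_ne _ _ (Fin.succAbove_right_injective hh)
    change σ _ = σ _
    rw [hu true]
    refine (key _).trans ?_
    rw [← hu false]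

theorem cubeFreeBoundary_degenerate (R : Type*) [CommRing R] {V : Type*} (G : SimpleGraph V)
    (n : ℕ) : cubeDegenerate R G (n + 1) ≤
      (cubeDegenerate R G n).comap (cubeFreeBoundary R G n) := by
  refine Submodule.span_le.2 ?_
  rintro _ ⟨σ, ⟨i, hi⟩, rfl⟩
  simp only [SetLike.mem_coe, Submodule.mem_comap, cubeFreeBoundary,
    Finsupp.linearCombination_single, one_smul]
  refine Submodule.sum_mem _ fun j _ => Submodule.smul_mem _ _ ?_
  by_cases hj : i = j
  · subst hj; rw [hi, sub_self]; exact Submodule.zero_mem _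
  · exact Submodule.sub_mem _
      (Submodule.subset_span ⟨_, isDegenerateCube_face hi _ hj, rfl⟩)
      (Submodule.subset_span ⟨_, isDegenerateCube_face hi _ hj, rfl⟩)

/-- The chain module `C_n = L_n / D_n`. -/
abbrev CubeChain (R : Type*) [CommRing R] {V : Type*} (G : SimpleGraph V) (n : ℕ) :=
  (SingularCube G n →₀ R) ⧸ cubeDegenerate R G n

/-- The boundary `C_{n+1} → C_n`. -/
noncomputable def cubeBoundary (R : Type*) [CommRing R] {V : Type*} (G : SimpleGraph V)
    (n : ℕ) : CubeChain R G (n + 1) →ₗ[R] CubeChain R G n :=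
  Submodule.mapQ _ _ (cubeFreeBoundary R G n) (cubeFreeBoundary_degenerate R G n)

/-- The kernel of `∂_n` (with `∂_0 = 0`). -/
noncomputable def cubeCycles (R : Type*) [CommRing R] {V : Type*} (G : SimpleGraph V) :
    (n : ℕ) → Submodule R (CubeChain R G n)
  | 0 => ⊤
  | n + 1 => LinearMap.ker (cubeBoundary R G n)

/-- The `n`-th cubical homology `ker ∂_n / im ∂_{n+1}` of `G` with coefficients in `R`. -/
abbrev CubeHomology (R : Type*) [CommRing R] {V : Type*} (G : SimpleGraph V) (n : ℕ) :=
  cubeCycles R G n ⧸ (LinearMap.range (cubeBoundary R G n)).submoduleOf (cubeCycles R G n)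

/-! ### Path homology -/

/-- The submodule generated by the tuples `(v_0, …, v_n)` with `v_i = v_{i+1}` for some `i`. -/
noncomputable def pathDegenerate (R : Type*) [CommRing R] (V : Type*) (n : ℕ) :
    Submodule R ((Fin (n + 1) → V) →₀ R) :=
  Submodule.span R {x | ∃ v : Fin (n + 1) → V,
    (∃ i : Fin n, v i.castSucc = v i.succ) ∧ x = Finsupp.single v 1}

/-- The boundary `(v_0, …, v_{n+1}) ↦ ∑ (-1)^i (v_0, …, omit v_i, …, v_{n+1})`. -/
noncomputable def pathFreeBoundary (R : Type*) [CommRing R] (V : Type*) (n : ℕ) :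
    ((Fin (n + 2) → V) →₀ R) →ₗ[R] ((Fin (n + 1) → V) →₀ R) :=
  Finsupp.linearCombination R fun v => ∑ i : Fin (n + 2),
    (-1 : R) ^ (i : ℕ) • Finsupp.single (i.removeNth v) (1 : R)

theorem removeNth_degenerate {V : Type*} {n : ℕ} {v : Fin (n + 2) → V} {i : Fin (n + 1)}
    (h : v i.castSucc = v i.succ) {k : Fin (n + 2)} (h1 : k ≠ i.castSucc) (h2 : k ≠ i.succ) :
    ∃ j : Fin n, (k.removeNth v : Fin (n + 1) → V) j.castSucc = k.removeNth v j.succ := by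
  obtain ⟨i, hi⟩ := i
  obtain ⟨k, hk⟩ := k
  simp only [Fin.castSucc_mk, Fin.succ_mk, ne_eq, Fin.mk.injEq] at h h1 h2
  rcases lt_or_gt_of_ne h1 with hlt | hgt
  · refine ⟨⟨i - 1, by omega⟩, ?_⟩
    simp only [Fin.removeNth, Fin.castSucc_mk, Fin.succ_mk]
    rw [Fin.succAbove_of_le_castSucc _ _ (by simp [Fin.le_def]; omega),
      Fin.succAbove_of_le_castSucc _ _ (by simp [Fin.le_def]; omega)]
    simp only [Fin.succ_mk]
    have e : i - 1 + 1 = i := by omega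
    simpa only [e] using h
  · refine ⟨⟨i, by omega⟩, ?_⟩
    simp only [Fin.removeNth, Fin.castSucc_mk, Fin.succ_mk]
    rw [Fin.succAbove_of_castSucc_lt _ _ (by simp [Fin.lt_def]; omega),
      Fin.succAbove_of_castSucc_lt _ _ (by simp [Fin.lt_def]; omega)]
    simpa only [Fin.castSucc_mk] using h

theorem removeNth_eq_of_degenerate {V : Type*} {n : ℕ} {v : Fin (n + 2) → V} {i : Fin (n + 1)}
    (h : v i.castSucc = v i.succ) :
    (i.castSucc.removeNth v : Fin (n + 1) → V) = i.succ.removeNth v := by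
  funext l
  simp only [Fin.removeNth]
  rcases lt_trichotomy l i with hl | rfl | hl
  · rw [Fin.succAbove_of_castSucc_lt _ _ (by simpa using hl),
      Fin.succAbove_of_castSucc_lt _ _ (by rw [Fin.lt_def] at *; simp; omega)]
  · simpa using h.symm
  · rw [Fin.succAbove_of_le_castSucc _ _ (by simpa using hl.le),
      Fin.succAbove_of_le_castSucc _ _ (by rw [Fin.lt_def] at hl; rw [Fin.le_def]; simp; omega)]

theorem pathFreeBoundary_degenerate (R : Type*) [CommRing R] (V : Type*) (n : ℕ) :
    pathDegenerate R V (n + 1) ≤ (pathDegenerate R V n).comap (pathFreeBoundary R V n) := by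
  refine Submodule.span_le.2 ?_
  rintro _ ⟨v, ⟨i, hi⟩, rfl⟩
  simp only [SetLike.mem_coe, Submodule.mem_comap, pathFreeBoundary,
    Finsupp.linearCombination_single, one_smul]
  have hne : i.castSucc ≠ i.succ := Fin.castSucc_lt_succ.ne
  rw [← Finset.add_sum_erase _ _ (Finset.mem_univ i.castSucc),
    ← Finset.add_sum_erase _ _ (Finset.mem_erase.2 ⟨hne.symm, Finset.mem_univ i.succ⟩),
    ← add_assoc]
  refine Submodule.add_mem _ ?_ (Submodule.sum_mem _ fun k hk => Submodule.smul_mem _ _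
    (Submodule.subset_span ⟨_, ?_, rfl⟩))
  · rw [removeNth_eq_of_degenerate hi]
    simp [pow_succ]
  · simp only [Finset.mem_erase] at hk
    exact removeNth_degenerate hi hk.2.1 hk.1

/-- The module `C_n(V)` of all tuples modulo degenerate ones. -/
abbrev PathChain (R : Type*) [CommRing R] (V : Type*) (n : ℕ) :=
  ((Fin (n + 1) → V) →₀ R) ⧸ pathDegenerate R V n

/-- The boundary `C_{n+1}(V) → C_n(V)`. -/
noncomputable def pathBoundary (R : Type*) [CommRing R] (V : Type*) (n : ℕ) :
    PathChain R V (n + 1) →ₗ[R] PathChain R V n :=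
  Submodule.mapQ _ _ (pathFreeBoundary R V n) (pathFreeBoundary_degenerate R V n)

/-- The submodule of `C_n(V)` generated by the cosets of the paths of `G`. -/
noncomputable def allowedPathChains (R : Type*) [CommRing R] {V : Type*} (G : SimpleGraph V) (n : ℕ) :
    Submodule R (PathChain R V n) :=
  Submodule.span R {x | ∃ v : Fin (n + 1) → V, (∀ i : Fin n, G.Adj (v i.castSucc) (v i.succ)) ∧
    x = Submodule.Quotient.mk (Finsupp.single v 1)}

/-- The module `C_n(G)` of the allowed chains whose boundary is allowed. -/
noncomputable def pathChains (R : Type*) [CommRing R] {V : Type*} (G : SimpleGraph V) :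
    (n : ℕ) → Submodule R (PathChain R V n)
  | 0 => allowedPathChains R G 0
  | n + 1 => allowedPathChains R G (n + 1) ⊓ (allowedPathChains R G n).comap (pathBoundary R V n)

/-- The kernel of `∂_n` on `C_n(G)` (with `∂_0 = 0`). -/
noncomputable def pathCycles (R : Type*) [CommRing R] {V : Type*} (G : SimpleGraph V) :
    (n : ℕ) → Submodule R (PathChain R V n)
  | 0 => pathChains R G 0
  | n + 1 => pathChains R G (n + 1) ⊓ LinearMap.ker (pathBoundary R V n)

/-- The image of `∂_{n+1}` on `C_{n+1}(G)`. -/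
noncomputable def pathBoundaries (R : Type*) [CommRing R] {V : Type*} (G : SimpleGraph V)
    (n : ℕ) : Submodule R (PathChain R V n) :=
  (pathChains R G (n + 1)).map (pathBoundary R V n)

/-- The `n`-th path homology `ker ∂_n / im ∂_{n+1}` of `G` with coefficients in `R`. -/
abbrev PathHomology (R : Type*) [CommRing R] {V : Type*} (G : SimpleGraph V) (n : ℕ) :=
  pathCycles R G n ⧸ (pathBoundaries R G n).submoduleOf (pathCycles R G n)

/-! ### The discrete fundamental group -/

/-- The two-sided infinite path with vertex set `ℤ`. -/
def intPath : SimpleGraph ℤ where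
  Adj i j := j = i + 1 ∨ i = j + 1
  symm := ⟨fun _ _ h => h.symm⟩
  loopless := ⟨fun i h => by omega⟩

/-- Discrete loops at `v₀`: graph maps from the infinite path to `G` that take the value `v₀`
outside a finite interval. -/
@[ext]
structure Loop {V : Type*} (G : SimpleGraph V) (v₀ : V) extends GraphMap intPath G where
  stable : ∃ N : ℕ, ∀ i : ℤ, (N : ℤ) ≤ |i| → toFun i = v₀

variable {V : Type*} {G : SimpleGraph V} {v₀ : V}

instance : CoeFun (Loop G v₀) (fun _ => ℤ → V) := ⟨fun f => f.toFun⟩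

/-- Discrete homotopy of loops: a graph map on the grid `ℤ □ {0, …, m}` that restricts to the two
loops on the two ends and is `v₀` outside finitely many columns. -/
def Homotopic (f g : Loop G v₀) : Prop :=
  ∃ (m : ℕ) (H : GraphMap (intPath.boxProd (SimpleGraph.pathGraph (m + 1))) G),
    (∀ i, H (i, 0) = f i) ∧ (∀ i, H (i, Fin.last m) = g i) ∧
    ∃ N : ℕ, ∀ (i : ℤ) (j : Fin (m + 1)), (N : ℤ) ≤ |i| → H (i, j) = v₀

/-- Homotopy in one step. -/
def Near (f g : Loop G v₀) : Prop := ∀ i, f i = g i ∨ G.Adj (f i) (g i)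

theorem Near.symm {f g : Loop G v₀} (h : Near f g) : Near g f := fun i =>
  (h i).imp Eq.symm SimpleGraph.Adj.symm

theorem Loop.ext_fun {f g : Loop G v₀} (h : ∀ i, f i = g i) : f = g := by
  ext i; exact h i

theorem Homotopic.refl (f : Loop G v₀) : Homotopic f f := by
  obtain ⟨N, hN⟩ := f.stable
  refine ⟨0, ⟨fun p => f p.1, ?_⟩, fun _ => rfl, fun _ => rfl, N, fun i _ hi => hN i hi⟩
  rintro ⟨a, k⟩ ⟨b, l⟩ h
  rcases SimpleGraph.boxProd_adj.1 h with ⟨h, -⟩ | ⟨-, h⟩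
  · exact f.map_adj _ _ h
  · exact Or.inl (congrArg f.toFun h)

theorem Homotopic.step {f g k : Loop G v₀} (h : Homotopic f g) (hs : Near g k) :
    Homotopic f k := by
  obtain ⟨m, H, h0, h1, N, hN⟩ := h
  obtain ⟨M, hM⟩ := k.stable
  have hlast : ∀ (i : ℤ) (a : ℕ) (ha : a < m + 1), a = m → H (i, ⟨a, ha⟩) = g i := by
    rintro i a ha rfl; exact h1 i
  refine ⟨m + 1, ⟨fun p => if hp : (p.2 : ℕ) < m + 1 then H (p.1, ⟨p.2, hp⟩) else k p.1, ?_⟩,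
    ?_, ?_, max N M, ?_⟩
  · rintro ⟨a, x, hx⟩ ⟨b, y, hy⟩ hab
    rcases SimpleGraph.boxProd_adj.1 hab with ⟨hh, he⟩ | ⟨hh, he⟩
    · simp only [Fin.mk.injEq] at he
      subst he
      by_cases hx' : x < m + 1
      · simp only [hx', dif_pos]
        exact H.map_adj _ _ (SimpleGraph.boxProd_adj.2 (Or.inl ⟨hh, rfl⟩))
      · simp only [hx', dif_neg, not_false_iff]
        exact k.map_adj _ _ hh
    · simp only at he
      subst he
      rw [SimpleGraph.pathGraph_adj] at hh
      simp only at hh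
      by_cases hx' : x < m + 1 <;> by_cases hy' : y < m + 1
      · simp only [hx', hy', dif_pos]
        refine H.map_adj _ _ (SimpleGraph.boxProd_adj.2 (Or.inr ⟨?_, rfl⟩))
        rw [SimpleGraph.pathGraph_adj]
        exact hh
      · simp only [hx', hy', dif_pos, dif_neg, not_false_iff]
        rw [hlast _ _ _ (by omega)]
        exact hs a
      · simp only [hx', hy', dif_pos, dif_neg, not_false_iff]
        rw [hlast _ _ _ (by omega)]
        exact hs.symm a
      · omega
  · intro i
    have : ((0 : Fin (m + 1 + 1)) : ℕ) < m + 1 := by simp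
    simp only [this, dif_pos]
    exact h0 i
  · intro i
    simp
  · intro i j hi
    have hi1 : (N : ℤ) ≤ |i| := le_trans (by simp) hi
    have hi2 : (M : ℤ) ≤ |i| := le_trans (by simp) hi
    by_cases hj : (j : ℕ) < m + 1
    · simp only [hj, dif_pos]; exact hN _ _ hi1
    · simp only [hj, dif_neg, not_false_iff]; exact hM _ hi2

theorem homotopic_iff {f g : Loop G v₀} :
    Homotopic f g ↔ Relation.ReflTransGen Near f g := by
  constructor
  · rintro ⟨m, H, h0, h1, N, hN⟩
    let L : Fin (m + 1) → Loop G v₀ := fun j =>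
      { toFun := fun i => H (i, j)
        map_adj := fun a b h => H.map_adj _ _ (SimpleGraph.boxProd_adj.2 (Or.inl ⟨h, rfl⟩))
        stable := ⟨N, fun i hi => hN i j hi⟩ }
    have key : ∀ j : Fin (m + 1), Relation.ReflTransGen Near (L 0) (L j) := by
      intro j
      induction j using Fin.induction with
      | zero => exact .refl
      | succ j ih =>
        refine ih.tail fun i => H.map_adj _ _ (SimpleGraph.boxProd_adj.2 (Or.inr ⟨?_, rfl⟩))
        rw [SimpleGraph.pathGraph_adj]
        simp
    have e0 : L 0 = f := Loop.ext_fun h0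
    have e1 : L (Fin.last m) = g := Loop.ext_fun h1
    rw [← e0, ← e1]
    exact key _
  · intro h
    induction h with
    | refl => exact Homotopic.refl f
    | tail _ hs ih => exact ih.step hs

theorem Near.homotopic {f g : Loop G v₀} (h : Near f g) : Homotopic f g :=
  (Homotopic.refl f).step h

theorem Homotopic.trans {f g k : Loop G v₀} (h : Homotopic f g) (h' : Homotopic g k) :
    Homotopic f k :=
  homotopic_iff.2 ((homotopic_iff.1 h).trans (homotopic_iff.1 h'))

theorem Homotopic.symm {f g : Loop G v₀} (h : Homotopic f g) : Homotopic g f := by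
  rw [homotopic_iff] at *
  induction h with
  | refl => exact .refl
  | tail _ hs ih => exact Relation.ReflTransGen.head hs.symm ih

/-- The loop that runs through `f` up to time `a` and then through the translate of `g` by `c`. -/
def glue (f g : Loop G v₀) (a c : ℤ) (hf : ∀ i, a ≤ i → f i = v₀)
    (hg : ∀ i, i ≤ a - c → g i = v₀) : Loop G v₀ where
  toFun i := if i ≤ a then f i else g (i - c)
  map_adj := by
    have key : ∀ i : ℤ, (if i ≤ a then f i else g (i - c)) =
        (if i + 1 ≤ a then f (i + 1) else g (i + 1 - c)) ∨
        G.Adj (if i ≤ a then f i else g (i - c))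
          (if i + 1 ≤ a then f (i + 1) else g (i + 1 - c)) := by
      intro i
      rcases lt_trichotomy i a with h | h | h
      · rw [if_pos h.le, if_pos (by omega)]
        exact f.map_adj _ _ (Or.inl rfl)
      · rw [if_pos h.le, if_neg (by omega), (hf i h.ge).trans (hg (i - c) (by omega)).symm]
        exact g.map_adj _ _ (Or.inl (by ring))
      · rw [if_neg (by omega), if_neg (by omega)]
        exact g.map_adj _ _ (Or.inl (by ring))
    rintro i j (rfl | rfl)
    · exact key i
    · exact (key j).imp Eq.symm SimpleGraph.Adj.symm
  stable := by
    obtain ⟨N, hN⟩ := f.stable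
    obtain ⟨M, hM⟩ := g.stable
    refine ⟨N + M + c.natAbs, fun i hi => ?_⟩
    push_cast at hi
    have h3 := abs_nonneg c
    split_ifs with h
    · exact hN i (by omega)
    · refine hM _ ?_
      have h1 := abs_sub_abs_le_abs_sub i c
      have h2 := Int.natCast_natAbs c
      omega

theorem glue_shift (f g : Loop G v₀) (a c c' : ℤ) (hf) (hg) (hg') (h : c ≤ c') :
    Homotopic (glue f g a c hf hg) (glue f g a c' hf hg') := by
  obtain ⟨n, rfl⟩ := Int.le.dest h
  clear h
  induction n with
  | zero =>
    have : (glue f g a c hf hg) = (glue f g a (c + ((0 : ℕ) : ℤ)) hf hg') := by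
      apply Loop.ext_fun; intro i; simp [glue]
    rw [this]; exact .refl _
  | succ n ih =>
    have hg'' : ∀ i, i ≤ a - (c + (n : ℤ)) → g i = v₀ := fun i hi => hg i (by omega)
    refine (ih hg'').step fun i => ?_
    simp only [glue]
    split_ifs with h
    · exact Or.inl rfl
    · exact g.map_adj _ _ (Or.inr (by push_cast; ring))

theorem glue_homotopic (f g : Loop G v₀) (a c a' c' : ℤ) (hf) (hg) (hf') (hg') :
    Homotopic (glue f g a c hf hg) (glue f g a' c' hf' hg') := by
  wlog h : a ≤ a' generalizing a a' c c'
  · exact (this a' c' a c hf' hg' hf hg (by omega)).symm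
  have h1 : ∀ i, i ≤ a - max c c' → g i = v₀ := fun i hi => hg i (by omega)
  have h2 : ∀ i, i ≤ a' - max c c' → g i = v₀ := fun i hi => hg' i (by omega)
  refine (glue_shift f g a c (max c c') hf hg h1 (le_max_left _ _)).trans ?_
  have e : glue f g a (max c c') hf h1 = glue f g a' (max c c') hf' h2 := by
    apply Loop.ext_fun
    intro i
    simp only [glue]
    split_ifs with h3 h4 h4
    · rfl
    · omega
    · rw [hf i (by omega), h2 _ (by omega)]
    · rfl
  rw [e]
  exact (glue_shift f g a' c' (max c c') hf' hg' h2 (le_max_right _ _)).symm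

/-- A number `N` such that the loop is `v₀` at all `i` with `N ≤ |i|`. -/
noncomputable def Loop.radius (f : Loop G v₀) : ℕ := f.stable.choose

theorem Loop.eq_right (f : Loop G v₀) (i : ℤ) (h : (f.radius : ℤ) ≤ i) : f i = v₀ :=
  f.stable.choose_spec i (h.trans (le_abs_self i))

theorem Loop.eq_left (f : Loop G v₀) (i : ℤ) (h : i ≤ -(f.radius : ℤ)) : f i = v₀ :=
  f.stable.choose_spec i (le_trans (by change (f.radius : ℤ) ≤ -i; omega) (neg_le_abs i))

/-- Concatenation of loops. -/
noncomputable def Loop.concat (f g : Loop G v₀) : Loop G v₀ :=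
  glue f g f.radius (f.radius + g.radius) f.eq_right fun i hi => g.eq_left i (by omega)

/-- The constant loop. -/
def Loop.const (G : SimpleGraph V) (v₀ : V) : Loop G v₀ where
  toFun _ := v₀
  map_adj _ _ _ := Or.inl rfl
  stable := ⟨0, fun _ _ => rfl⟩

/-- The loop run backwards. -/
def Loop.reverse (f : Loop G v₀) : Loop G v₀ where
  toFun i := f (-i)
  map_adj i j h := f.map_adj _ _ (by
    rcases h with rfl | rfl
    · exact Or.inr (by ring)
    · exact Or.inl (by ring))
  stable := by
    obtain ⟨N, hN⟩ := f.stable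
    exact ⟨N, fun i hi => hN _ (by rwa [abs_neg])⟩

theorem concat_homotopic_glue (f g : Loop G v₀) (a c : ℤ) (hf) (hg) :
    Homotopic (f.concat g) (glue f g a c hf hg) :=
  glue_homotopic ..

theorem Near.concat_left {f f' : Loop G v₀} (h : Near f f') (g : Loop G v₀) :
    Homotopic (f.concat g) (f'.concat g) := by
  have hf : ∀ i, max (f.radius : ℤ) f'.radius ≤ i → f i = v₀ := fun i hi =>
    f.eq_right i (by omega)
  have hf' : ∀ i, max (f.radius : ℤ) f'.radius ≤ i → f' i = v₀ := fun i hi =>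
    f'.eq_right i (by omega)
  have hg : ∀ i, i ≤ max (f.radius : ℤ) f'.radius - (max (f.radius : ℤ) f'.radius + g.radius) →
    g i = v₀ := fun i hi => g.eq_left i (by omega)
  refine (concat_homotopic_glue f g _ _ hf hg).trans
    (Homotopic.trans (Near.homotopic fun i => ?_) (concat_homotopic_glue f' g _ _ hf' hg).symm)
  simp only [glue]
  split_ifs
  · exact h i
  · exact Or.inl rfl

theorem Near.concat_right (f : Loop G v₀) {g g' : Loop G v₀} (h : Near g g') :
    Homotopic (f.concat g) (f.concat g') := by
  have hg : ∀ i, i ≤ (f.radius : ℤ) - (f.radius + max (g.radius : ℤ) g'.radius) →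
    g i = v₀ := fun i hi => g.eq_left i (by omega)
  have hg' : ∀ i, i ≤ (f.radius : ℤ) - (f.radius + max (g.radius : ℤ) g'.radius) →
    g' i = v₀ := fun i hi => g'.eq_left i (by omega)
  refine (concat_homotopic_glue f g _ _ f.eq_right hg).trans
    (Homotopic.trans (Near.homotopic fun i => ?_)
      (concat_homotopic_glue f g' _ _ f.eq_right hg').symm)
  simp only [glue]
  split_ifs
  · exact Or.inl rfl
  · exact h _

theorem Homotopic.concat {f f' g g' : Loop G v₀} (h : Homotopic f f') (h' : Homotopic g g') :
    Homotopic (f.concat g) (f'.concat g') := by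
  have h1 : Homotopic (f.concat g) (f'.concat g) := by
    rw [homotopic_iff] at h
    induction h with
    | refl => exact .refl _
    | tail _ hs ih => exact ih.trans (hs.concat_left g)
  refine h1.trans ?_
  rw [homotopic_iff] at h'
  induction h' with
  | refl => exact .refl _
  | tail _ hs ih => exact ih.trans (Near.concat_right f' hs)

theorem Homotopic.reverse {f g : Loop G v₀} (h : Homotopic f g) :
    Homotopic f.reverse g.reverse := by
  rw [homotopic_iff] at *
  induction h with
  | refl => exact .refl
  | tail _ hs ih => exact ih.tail fun i => hs (-i)

theorem concat_assoc (f g h : Loop G v₀) :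
    Homotopic ((f.concat g).concat h) (f.concat (g.concat h)) := by
  obtain ⟨F, hF⟩ : ∃ F : ℤ, F = f.radius := ⟨_, rfl⟩
  obtain ⟨K, hK⟩ : ∃ K : ℤ, K = g.radius := ⟨_, rfl⟩
  obtain ⟨L, hL⟩ : ∃ L : ℤ, L = h.radius := ⟨_, rfl⟩
  have p1 : ∀ i, F + 2 * K ≤ i → f.concat g i = v₀ := by
    intro i hi
    simp only [Loop.concat, glue]
    split_ifs with h1
    · exact f.eq_right i (by omega)
    · exact g.eq_right _ (by omega)
  have p2 : ∀ i, i ≤ F + 2 * K - (F + 2 * K + L) → h i = v₀ := fun i hi => h.eq_left i (by omega)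
  have p4 : ∀ i, F ≤ i → f i = v₀ := fun i hi => f.eq_right i (by omega)
  have p3 : ∀ i, i ≤ F - (F + K) → g.concat h i = v₀ := by
    intro i hi
    simp only [Loop.concat, glue]
    split_ifs with h1
    · exact g.eq_left i (by omega)
    · exact h.eq_left _ (by omega)
  refine (concat_homotopic_glue (f.concat g) h (F + 2 * K) (F + 2 * K + L) p1 p2).trans
    (Homotopic.trans ?_ (concat_homotopic_glue f (g.concat h) F (F + K) p4 p3).symm)
  have e : glue (f.concat g) h (F + 2 * K) (F + 2 * K + L) p1 p2 =
      glue f (g.concat h) F (F + K) p4 p3 := by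
    apply Loop.ext_fun
    intro i
    simp only [glue, Loop.concat]
    split_ifs <;> first | rfl | omega | (congr 1; omega)
  rw [e]
  exact .refl _

theorem const_concat (f : Loop G v₀) : Homotopic ((Loop.const G v₀).concat f) f := by
  have h1 : ∀ i, -(f.radius : ℤ) ≤ i → Loop.const G v₀ i = v₀ := fun _ _ => rfl
  have h2 : ∀ i, i ≤ -(f.radius : ℤ) - 0 → f i = v₀ := fun i hi => f.eq_left i (by omega)
  have e : glue (Loop.const G v₀) f _ _ h1 h2 = f := by
    apply Loop.ext_fun
    intro i
    simp only [glue, sub_zero]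
    split_ifs with h
    · exact (f.eq_left i h).symm
    · rfl
  have := concat_homotopic_glue (Loop.const G v₀) f _ _ h1 h2
  rwa [e] at this

theorem reverse_concat (f : Loop G v₀) : Homotopic (f.reverse.concat f) (Loop.const G v₀) := by
  obtain ⟨N, hN⟩ : ∃ N : ℤ, N = f.radius := ⟨_, rfl⟩
  have h1 : ∀ i, N ≤ i → f.reverse i = v₀ := fun i hi => f.eq_left (-i) (by omega)
  have h2 : ∀ i, i ≤ N - 2 * N → f i = v₀ := fun i hi => f.eq_left i (by omega)
  refine (concat_homotopic_glue f.reverse f _ _ h1 h2).trans ?_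
  let T : ℕ → Loop G v₀ := fun j =>
    { toFun := fun i => f (|i - N| - N + j)
      map_adj := by
        have key : ∀ i : ℤ, f (|i - N| - N + j) = f (|i + 1 - N| - N + j) ∨
            G.Adj (f (|i - N| - N + j)) (f (|i + 1 - N| - N + j)) := by
          intro i
          refine f.map_adj _ _ ?_
          rcases le_or_gt N i with h | h
          · rw [abs_of_nonneg (by omega : 0 ≤ i - N), abs_of_nonneg (by omega : 0 ≤ i + 1 - N)]
            exact Or.inl (by ring)
          · rw [abs_of_nonpos (by omega : i - N ≤ 0), abs_of_nonpos (by omega : i + 1 - N ≤ 0)]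
            exact Or.inr (by ring)
        rintro a b (rfl | rfl)
        · exact key a
        · exact (key b).imp Eq.symm SimpleGraph.Adj.symm
      stable := ⟨3 * f.radius, fun i hi => f.eq_right _ (by
        have := abs_sub_abs_le_abs_sub i N
        rw [abs_of_nonneg (by omega : 0 ≤ N)] at this
        push_cast at hi
        omega)⟩ }
  have hT : ∀ j, Homotopic (T 0) (T j) := by
    intro j
    induction j with
    | zero => exact .refl _
    | succ j ih =>
      exact ih.step fun i => f.map_adj _ _ (Or.inl (by push_cast; ring))
  have e0 : glue f.reverse f N (2 * N) h1 h2 = T 0 := by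
    apply Loop.ext_fun
    intro i
    simp only [glue, T, Loop.reverse]
    split_ifs with h
    · rw [abs_of_nonpos (by omega)]; congr 1; push_cast; ring
    · rw [abs_of_nonneg (by omega)]; congr 1; push_cast; ring
  have e1 : T (2 * f.radius) = Loop.const G v₀ := by
    apply Loop.ext_fun
    intro i
    refine f.eq_right _ ?_
    have := abs_nonneg (i - N)
    push_cast
    omega
  rw [e0, ← e1]
  exact hT _

/-- Homotopy of loops as an equivalence relation. -/
instance loopSetoid (G : SimpleGraph V) (v₀ : V) : Setoid (Loop G v₀) where
  r := Homotopic
  iseqv := ⟨Homotopic.refl, Homotopic.symm, Homotopic.trans⟩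

/-- The discrete fundamental group `A_1(G, v₀)`: homotopy classes of discrete loops at `v₀`. -/
def A1 (G : SimpleGraph V) (v₀ : V) := Quotient (loopSetoid G v₀)

/-- The group structure is given by concatenation of loops. -/
noncomputable instance (G : SimpleGraph V) (v₀ : V) : Group (A1 G v₀) :=
  letI : Mul (A1 G v₀) := ⟨Quotient.map₂ Loop.concat fun _ _ h _ _ h' => Homotopic.concat h h'⟩
  letI : One (A1 G v₀) := ⟨Quotient.mk _ (Loop.const G v₀)⟩
  letI : Inv (A1 G v₀) := ⟨Quotient.map Loop.reverse fun _ _ h => Homotopic.reverse h⟩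
  Group.ofLeftAxioms
    (by
      rintro ⟨f⟩ ⟨g⟩ ⟨h⟩
      exact Quotient.sound (concat_assoc f g h))
    (by
      rintro ⟨f⟩
      exact Quotient.sound (const_concat f))
    (by
      rintro ⟨f⟩
      exact Quotient.sound (reverse_concat f))

end DiscreteHomology

/-! Call two vertices weakly adjacent if they are equal or joined by an edge. A 1-cube is a weakly
adjacent pair, and a 2-cube is a closed walk a, b, c, d of weakly adjacent vertices, with boundary
ab + bc - ad - dc. So every question about cubical homology in degree one concerns functions on
pairs that vanish on the diagonal and respect this square relation.

For path homology, `cubeToPath` sends the edge ab to the pair (a, b). It is injective, its image is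
the module of allowed 1-chains, and it matches the cycles. A square goes to the boundary of (a, b,
c) - (a, d, c), whose diagonals (a, c) cancel. Conversely, if an allowed 2-chain has allowed
boundary, its diagonals over non-adjacent a, c cancel in total; fixing one midpoint for each such
pair rewrites the boundary as a sum of squares (`pathBoundaries_one_le`).

For the fundamental group, a loop is sent to the sum of its edges. A one-step homotopy is a strip of
squares whose rungs telescope away, so the sum is a homotopy invariant modulo boundaries, and
`hurewicz` is its R-linear extension. For the inverse, choose for every vertex a path to the base
point and send an edge ab to the class of the loop that comes in to a, crosses to b and returns
(`weightHom`). Squares are respected because the loops through a, b, c and a, d, c are homotopic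
(`bridge₂_homotopic`). A loop is the product of the loops of its edges (`cut_succ`,
`finsum_weight`), so `weightHom` is a left inverse of `hurewicz`; the other composite is the
identity plus a term that factors through the boundary (`hurewicz_weightHom`), hence the identity on
cycles. This works directly over R, with no universal coefficient argument. -/

namespace DiscreteHomology

/-! ### Cubical chains in degrees zero, one and two. -/

section CubesAndPaths

variable {V : Type*} {G : SimpleGraph V} {R : Type*} [CommRing R]

/-- Two vertices are weakly adjacent if they are equal or joined by an edge. -/
def WeakAdj (G : SimpleGraph V) (a b : V) : Prop := a = b ∨ G.Adj a b

theorem WeakAdj.refl (a : V) : WeakAdj G a a := Or.inl rfl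

theorem WeakAdj.symm {a b : V} (h : WeakAdj G a b) : WeakAdj G b a :=
  h.imp Eq.symm SimpleGraph.Adj.symm

/-- The singular 1-cube with ends `a` and `b`. -/
def edgeCube {a b : V} (h : WeakAdj G a b) : SingularCube G 1 where
  toFun x := bif x 0 then b else a
  map_adj x y _ := by
    cases x 0 <;> cases y 0
    · exact Or.inl rfl
    · exact h
    · exact h.symm
    · exact Or.inl rfl

/-- The singular 2-cube with vertices `a`, `b`, `c`, `d` in cyclic order. -/
def squareCube {a b c d : V} (hab : WeakAdj G a b) (hbc : WeakAdj G b c)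
    (had : WeakAdj G a d) (hdc : WeakAdj G d c) : SingularCube G 2 where
  toFun x := bif x 0 then (bif x 1 then c else b) else (bif x 1 then d else a)
  map_adj x y h := by
    have h' : hammingDist x y = 1 := h
    simp only [hammingDist, Finset.card_filter, Fin.sum_univ_two] at h'
    generalize x 0 = x0 at *
    generalize x 1 = x1 at *
    generalize y 0 = y0 at *
    generalize y 1 = y1 at *
    cases x0 <;> cases x1 <;> cases y0 <;> cases y1 <;>
      first
      | exact absurd h' (by decide)
      | exact hab
      | exact hab.symm
      | exact hbc
      | exact hbc.symm
      | exact had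
      | exact had.symm
      | exact hdc
      | exact hdc.symm

theorem SingularCube.weakAdj (σ : SingularCube G 1) :
    WeakAdj G (σ fun _ => false) (σ fun _ => true) :=
  σ.map_adj _ _ (by simp [cubeGraph, hammingDist])

theorem SingularCube.eq_edgeCube (σ : SingularCube G 1) : σ = edgeCube σ.weakAdj := by
  ext x
  have hx : x = fun _ => x 0 := by
    funext i
    rw [Subsingleton.elim i 0]
  rw [hx]
  simp only [edgeCube]
  cases x 0 <;> rfl

theorem SingularCube.eq_squareCube (σ : SingularCube G 2) :
    ∃ (a b c d : V) (hab : WeakAdj G a b) (hbc : WeakAdj G b c) (had : WeakAdj G a d)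
      (hdc : WeakAdj G d c), σ = squareCube hab hbc had hdc := by
  refine ⟨σ ![false, false], σ ![true, false], σ ![true, true], σ ![false, true],
    σ.map_adj _ _ ?_, σ.map_adj _ _ ?_, σ.map_adj _ _ ?_, σ.map_adj _ _ ?_, ?_⟩
  any_goals
    change hammingDist _ _ = 1
    decide
  ext x
  have hx : x = ![x 0, x 1] := by
    funext i
    fin_cases i <;> rfl
  rw [hx]
  simp only [squareCube]
  cases x 0 <;> cases x 1 <;> rfl

open Classical in
/-- The class of the 1-cube with ends `a` and `b` (zero if there is none). -/
noncomputable def edgeChain (R : Type*) [CommRing R] (G : SimpleGraph V) (a b : V) :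
    CubeChain R G 1 :=
  if h : WeakAdj G a b then Submodule.Quotient.mk (Finsupp.single (edgeCube h) 1) else 0

theorem edgeChain_of_weakAdj {a b : V} (h : WeakAdj G a b) :
    edgeChain R G a b = Submodule.Quotient.mk (Finsupp.single (edgeCube h) 1) := dif_pos h

theorem isDegenerateCube_edgeCube_iff {a b : V} (h : WeakAdj G a b) :
    IsDegenerateCube (edgeCube h) ↔ a = b := by
  constructor
  · rintro ⟨i, hi⟩
    have := congrArg (fun τ : SingularCube G 0 => τ fun _ => false) hi
    rw [Fin.fin_one_eq_zero i] at this
    simpa [face, edgeCube] using this.symm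
  · rintro rfl
    refine ⟨0, ?_⟩
    ext x
    simp [face, edgeCube]

theorem edgeChain_self (a : V) : edgeChain R G a a = 0 := by
  rw [edgeChain_of_weakAdj (WeakAdj.refl a), Submodule.Quotient.mk_eq_zero]
  exact Submodule.subset_span ⟨_, (isDegenerateCube_edgeCube_iff _).2 rfl, rfl⟩

/-- A function on pairs of vertices that vanishes on the diagonal extends to 1-chains. -/
noncomputable def cubeLift {M : Type*} [AddCommGroup M] [Module R M] (G : SimpleGraph V)
    (φ : V → V → M) (hφ : ∀ a, φ a a = 0) : CubeChain R G 1 →ₗ[R] M :=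
  (cubeDegenerate R G 1).liftQ
    (Finsupp.linearCombination R fun σ => φ (σ fun _ => false) (σ fun _ => true)) (by
      rw [cubeDegenerate, Submodule.span_le]
      rintro _ ⟨σ, hσ, rfl⟩
      rw [σ.eq_edgeCube, isDegenerateCube_edgeCube_iff] at hσ
      simp only [SetLike.mem_coe, LinearMap.mem_ker, Finsupp.linearCombination_single, one_smul]
      rw [hσ, hφ])

theorem cubeLift_edgeChain {M : Type*} [AddCommGroup M] [Module R M] {φ : V → V → M}
    (hφ : ∀ a, φ a a = 0) {a b : V} (h : WeakAdj G a b) :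
    cubeLift G φ hφ (edgeChain R G a b) = φ a b := by
  rw [edgeChain_of_weakAdj h, cubeLift, Submodule.liftQ_apply]
  simp [edgeCube]

theorem cubeChain_hom_ext {M : Type*} [AddCommGroup M] [Module R M]
    {f g : CubeChain R G 1 →ₗ[R] M}
    (h : ∀ a b, WeakAdj G a b → f (edgeChain R G a b) = g (edgeChain R G a b)) : f = g := by
  refine Submodule.linearMap_qext _ (Finsupp.lhom_ext' fun σ => LinearMap.ext_ring ?_)
  have := h _ _ σ.weakAdj
  rwa [edgeChain_of_weakAdj σ.weakAdj, ← σ.eq_edgeCube] at this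

theorem cubeDegenerate_zero : cubeDegenerate R G 0 = ⊥ :=
  Submodule.span_eq_bot.2 (by rintro _ ⟨σ, hσ, -⟩; exact hσ.elim)

/-- The singular 0-cube at a vertex. -/
def pointCube (G : SimpleGraph V) (a : V) : SingularCube G 0 where
  toFun _ := a
  map_adj _ _ _ := Or.inl rfl

theorem SingularCube.eq_pointCube (σ : SingularCube G 0) : σ = pointCube G (σ fun _ => false) := by
  ext x
  exact congrArg σ.toFun (Subsingleton.elim _ _)

/-- The class of the 0-cube at a vertex. -/
noncomputable def pointChain (R : Type*) [CommRing R] (G : SimpleGraph V) (a : V) :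
    CubeChain R G 0 := Submodule.Quotient.mk (Finsupp.single (pointCube G a) 1)

/-- A function on vertices extends to 0-chains. -/
noncomputable def pointLift {M : Type*} [AddCommGroup M] [Module R M] (G : SimpleGraph V)
    (φ : V → M) : CubeChain R G 0 →ₗ[R] M :=
  (cubeDegenerate R G 0).liftQ (Finsupp.linearCombination R fun σ => φ (σ fun _ => false))
    (by rw [cubeDegenerate_zero]; exact bot_le)

theorem pointLift_pointChain {M : Type*} [AddCommGroup M] [Module R M] (φ : V → M) (a : V) :
    pointLift G φ (pointChain R G a) = φ a := by
  rw [pointLift, pointChain, Submodule.liftQ_apply]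
  simp [pointCube]

theorem pointChain_hom_ext {M : Type*} [AddCommGroup M] [Module R M]
    {f g : CubeChain R G 0 →ₗ[R] M} (h : ∀ a, f (pointChain R G a) = g (pointChain R G a)) :
    f = g := by
  refine Submodule.linearMap_qext _ (Finsupp.lhom_ext' fun σ => LinearMap.ext_ring ?_)
  have := h (σ fun _ => false)
  rwa [pointChain, ← σ.eq_pointCube] at this

theorem cubeBoundary_mk_single {n : ℕ} (σ : SingularCube G (n + 1)) :
    cubeBoundary R G n (Submodule.Quotient.mk (Finsupp.single σ 1)) =
      ∑ i : Fin (n + 1), (-1 : R) ^ ((i : ℕ) + 1) •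
        (Submodule.Quotient.mk (Finsupp.single (face false i σ) 1) -
          Submodule.Quotient.mk (Finsupp.single (face true i σ) 1)) := by
  rw [cubeBoundary, Submodule.mapQ_apply]
  simp only [cubeFreeBoundary, Finsupp.linearCombination_single, one_smul,
    ← Submodule.mkQ_apply, map_sum, map_smul, map_sub]

theorem cubeBoundary_edgeChain {a b : V} (h : WeakAdj G a b) :
    cubeBoundary R G 0 (edgeChain R G a b) = pointChain R G b - pointChain R G a := by
  have h0 : face false 0 (edgeCube h) = pointCube G a := by
    ext x; simp [face, edgeCube, pointCube]
  have h1 : face true 0 (edgeCube h) = pointCube G b := by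
    ext x; simp [face, edgeCube, pointCube]
  rw [edgeChain_of_weakAdj h, cubeBoundary_mk_single, Fin.sum_univ_one, h0, h1]
  simp [pointChain]

/-- The class of a singular 2-cube. -/
noncomputable def squareChain (R : Type*) [CommRing R] {a b c d : V} (hab : WeakAdj G a b)
    (hbc : WeakAdj G b c) (had : WeakAdj G a d) (hdc : WeakAdj G d c) : CubeChain R G 2 :=
  Submodule.Quotient.mk (Finsupp.single (squareCube hab hbc had hdc) 1)

theorem cubeBoundary_squareChain {a b c d : V} (hab : WeakAdj G a b)
    (hbc : WeakAdj G b c) (had : WeakAdj G a d) (hdc : WeakAdj G d c) :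
    cubeBoundary R G 1 (squareChain R hab hbc had hdc) =
      edgeChain R G a b + edgeChain R G b c - edgeChain R G a d - edgeChain R G d c := by
  have h1 : face false 0 (squareCube hab hbc had hdc) = edgeCube had := by
    ext x; rfl
  have h2 : face true 0 (squareCube hab hbc had hdc) = edgeCube hbc := by
    ext x; rfl
  have h3 : face false 1 (squareCube hab hbc had hdc) = edgeCube hab := by
    ext x; rfl
  have h4 : face true 1 (squareCube hab hbc had hdc) = edgeCube hdc := by
    ext x; rfl
  rw [squareChain, cubeBoundary_mk_single, Fin.sum_univ_two, h1, h2, h3, h4,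
    ← edgeChain_of_weakAdj, ← edgeChain_of_weakAdj, ← edgeChain_of_weakAdj,
    ← edgeChain_of_weakAdj]
  simp only [Fin.val_zero, Fin.val_one, zero_add, pow_one, neg_smul, one_smul]
  norm_num
  abel

/-- Every 2-cube is a square, so boundaries are generated by the square relations. All later claims
about boundaries are checked on these generators. -/
theorem range_cubeBoundary_one_le {N : Submodule R (CubeChain R G 1)}
    (h : ∀ {a b c d : V} (_ : WeakAdj G a b) (_ : WeakAdj G b c) (_ : WeakAdj G a d)
      (_ : WeakAdj G d c),
      edgeChain R G a b + edgeChain R G b c - edgeChain R G a d - edgeChain R G d c ∈ N) :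
    LinearMap.range (cubeBoundary R G 1) ≤ N := by
  rintro _ ⟨x, rfl⟩
  obtain ⟨x, rfl⟩ := Submodule.Quotient.mk_surjective _ x
  induction x using Finsupp.induction_linear with
  | zero => simp
  | add x y hx hy => rw [Submodule.Quotient.mk_add, map_add]; exact N.add_mem hx hy
  | single σ r =>
    obtain ⟨a, b, c, d, hab, hbc, had, hdc, rfl⟩ := σ.eq_squareCube
    rw [← mul_one r, ← smul_eq_mul, ← Finsupp.smul_single, Submodule.Quotient.mk_smul, map_smul]
    exact N.smul_mem _ (by
      have := cubeBoundary_squareChain (R := R) hab hbc had hdc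
      rw [squareChain] at this
      rw [this]
      exact h hab hbc had hdc)

/-! ### Comparison with path homology -/

/-- The class of a tuple. -/
noncomputable def tupleChain (R : Type*) [CommRing R] {n : ℕ} (v : Fin (n + 1) → V) :
    PathChain R V n := Submodule.Quotient.mk (Finsupp.single v 1)

theorem tupleChain_eq_zero {n : ℕ} {v : Fin (n + 1) → V} (i : Fin n)
    (h : v i.castSucc = v i.succ) : tupleChain R v = 0 :=
  (Submodule.Quotient.mk_eq_zero _).2 (Submodule.subset_span ⟨v, ⟨i, h⟩, rfl⟩)

theorem pathBoundary_tupleChain {n : ℕ} (v : Fin (n + 2) → V) :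
    pathBoundary R V n (tupleChain R v) =
      ∑ i : Fin (n + 2), (-1 : R) ^ (i : ℕ) • tupleChain R (i.removeNth v) := by
  rw [pathBoundary, tupleChain, Submodule.mapQ_apply]
  simp only [pathFreeBoundary, Finsupp.linearCombination_single, one_smul, tupleChain,
    ← Submodule.mkQ_apply, map_sum, map_smul]

theorem pathBoundary_pair (a b : V) :
    pathBoundary R V 0 (tupleChain R ![a, b]) = tupleChain R ![b] - tupleChain R ![a] := by
  have h0 : (0 : Fin 2).removeNth ![a, b] = ![b] := by
    funext i; fin_cases i; rfl
  have h1 : (1 : Fin 2).removeNth ![a, b] = ![a] := by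
    funext i; fin_cases i; rfl
  rw [pathBoundary_tupleChain, Fin.sum_univ_two, h0, h1]
  simp [sub_eq_add_neg]

theorem pathBoundary_triple (a b c : V) :
    pathBoundary R V 1 (tupleChain R ![a, b, c]) =
      tupleChain R ![b, c] - tupleChain R ![a, c] + tupleChain R ![a, b] := by
  have h0 : (0 : Fin 3).removeNth ![a, b, c] = ![b, c] := by
    funext i; fin_cases i <;> rfl
  have h1 : (1 : Fin 3).removeNth ![a, b, c] = ![a, c] := by
    funext i; fin_cases i <;> rfl
  have h2 : (2 : Fin 3).removeNth ![a, b, c] = ![a, b] := by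
    funext i; fin_cases i <;> rfl
  rw [pathBoundary_tupleChain, Fin.sum_univ_three, h0, h1, h2]
  simp [sub_eq_add_neg]

/-- A function on pairs of vertices that vanishes on the diagonal extends to `C_1(V)`. -/
noncomputable def pairLift {M : Type*} [AddCommGroup M] [Module R M]
    (φ : V → V → M) (hφ : ∀ a, φ a a = 0) : PathChain R V 1 →ₗ[R] M :=
  (pathDegenerate R V 1).liftQ (Finsupp.linearCombination R fun v => φ (v 0) (v 1)) (by
      rw [pathDegenerate, Submodule.span_le]
      rintro _ ⟨v, ⟨i, hi⟩, rfl⟩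
      rw [Subsingleton.elim i 0] at hi
      simp only [SetLike.mem_coe, LinearMap.mem_ker, Finsupp.linearCombination_single, one_smul]
      exact (congrArg (φ (v 0)) hi.symm).trans (hφ _))

theorem pairLift_pair {M : Type*} [AddCommGroup M] [Module R M] {φ : V → V → M}
    (hφ : ∀ a, φ a a = 0) (a b : V) : pairLift φ hφ (tupleChain R ![a, b]) = φ a b := by
  rw [pairLift, tupleChain, Submodule.liftQ_apply]
  simp

theorem pair_self (a : V) : tupleChain R ![a, a] = 0 := tupleChain_eq_zero (0 : Fin 1) rfl

/-- The comparison map from cubical to path chains in degree one. -/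
noncomputable def cubeToPath (R : Type*) [CommRing R] (G : SimpleGraph V) :
    CubeChain R G 1 →ₗ[R] PathChain R V 1 :=
  cubeLift G (fun a b => tupleChain R ![a, b]) pair_self

theorem cubeToPath_edgeChain {a b : V} (h : WeakAdj G a b) :
    cubeToPath R G (edgeChain R G a b) = tupleChain R ![a, b] := cubeLift_edgeChain _ h

/-- The left inverse must be defined on all pairs of vertices; this is why `edgeChain` has the value
zero where there is no 1-cube. -/
theorem cubeToPath_injective : Function.Injective (cubeToPath R G) := by
  have : (pairLift (edgeChain R G) edgeChain_self).comp (cubeToPath R G) = LinearMap.id :=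
    cubeChain_hom_ext fun a b h => by
      rw [LinearMap.comp_apply, cubeToPath_edgeChain h, pairLift_pair, LinearMap.id_apply]
  exact Function.LeftInverse.injective (g := pairLift (edgeChain R G) edgeChain_self)
    (LinearMap.congr_fun this)

theorem range_cubeToPath : LinearMap.range (cubeToPath R G) = allowedPathChains R G 1 := by
  apply le_antisymm
  · rintro _ ⟨x, rfl⟩
    obtain ⟨x, rfl⟩ := Submodule.Quotient.mk_surjective _ x
    induction x using Finsupp.induction_linear with
    | zero => simp
    | add x y hx hy => rw [Submodule.Quotient.mk_add, map_add]; exact add_mem hx hy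
    | single σ r =>
      rw [← mul_one r, ← smul_eq_mul, ← Finsupp.smul_single, Submodule.Quotient.mk_smul, map_smul]
      refine Submodule.smul_mem _ _ ?_
      rw [σ.eq_edgeCube, ← edgeChain_of_weakAdj, cubeToPath_edgeChain σ.weakAdj]
      rcases σ.weakAdj with h | h
      · rw [h, pair_self]; exact zero_mem _
      · refine Submodule.subset_span ⟨_, fun i => ?_, rfl⟩
        rw [Subsingleton.elim i 0]
        exact h
  · refine Submodule.span_le.2 ?_
    rintro _ ⟨v, hv, rfl⟩
    have h : WeakAdj G (v 0) (v 1) := Or.inr (hv 0)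
    refine ⟨edgeChain R G (v 0) (v 1), ?_⟩
    rw [cubeToPath_edgeChain h, tupleChain]
    congr 2
    funext i; fin_cases i <;> rfl

theorem pair_mem_allowed {a b : V} (h : WeakAdj G a b) :
    tupleChain R ![a, b] ∈ allowedPathChains R G 1 := by
  rw [← range_cubeToPath, ← cubeToPath_edgeChain h]
  exact ⟨_, rfl⟩

theorem triple_mem_allowed {a b c : V} (hab : WeakAdj G a b) (hbc : WeakAdj G b c) :
    tupleChain R ![a, b, c] ∈ allowedPathChains R G 2 := by
  rcases hab with h | hab
  · rw [tupleChain_eq_zero (0 : Fin 2) h]; exact zero_mem _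
  rcases hbc with h | hbc
  · rw [tupleChain_eq_zero (1 : Fin 2) h]; exact zero_mem _
  refine Submodule.subset_span ⟨_, fun i => ?_, rfl⟩
  fin_cases i
  · exact hab
  · exact hbc

theorem allowedPathChains_zero : allowedPathChains R G 0 = ⊤ := by
  rw [eq_top_iff]
  rintro x -
  obtain ⟨x, rfl⟩ := Submodule.Quotient.mk_surjective _ x
  induction x using Finsupp.induction_linear with
  | zero => simp
  | add x y hx hy => rw [Submodule.Quotient.mk_add]; exact add_mem hx hy
  | single v r =>
    rw [← mul_one r, ← smul_eq_mul, ← Finsupp.smul_single, Submodule.Quotient.mk_smul]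
    exact Submodule.smul_mem _ _ (Submodule.subset_span ⟨v, fun i => i.elim0, rfl⟩)

theorem pathCycles_one :
    pathCycles R G 1 = allowedPathChains R G 1 ⊓ LinearMap.ker (pathBoundary R V 0) := by
  simp [pathCycles, pathChains, allowedPathChains_zero]

theorem pathDegenerate_zero : pathDegenerate R V 0 = ⊥ :=
  Submodule.span_eq_bot.2 (by rintro _ ⟨σ, ⟨i, -⟩, -⟩; exact i.elim0)

/-- The comparison map in degree zero. -/
noncomputable def cubeToPathZero (R : Type*) [CommRing R] (G : SimpleGraph V) :
    CubeChain R G 0 →ₗ[R] PathChain R V 0 :=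
  pointLift G fun a => tupleChain R ![a]

theorem cubeToPathZero_injective : Function.Injective (cubeToPathZero R G) := by
  let r : PathChain R V 0 →ₗ[R] CubeChain R G 0 := (pathDegenerate R V 0).liftQ
    (Finsupp.linearCombination R fun v => pointChain R G (v 0))
    (by rw [pathDegenerate_zero]; exact bot_le)
  have : r.comp (cubeToPathZero R G) = LinearMap.id := pointChain_hom_ext fun a => by
    rw [LinearMap.comp_apply, cubeToPathZero, pointLift_pointChain, tupleChain,
      Submodule.liftQ_apply]
    simp
  exact Function.LeftInverse.injective (g := r) (LinearMap.congr_fun this)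

theorem pathBoundary_cubeToPath (x : CubeChain R G 1) :
    pathBoundary R V 0 (cubeToPath R G x) = cubeToPathZero R G (cubeBoundary R G 0 x) := by
  refine LinearMap.congr_fun (f := (pathBoundary R V 0).comp (cubeToPath R G))
    (g := (cubeToPathZero R G).comp (cubeBoundary R G 0)) (cubeChain_hom_ext fun a b h => ?_) x
  simp only [LinearMap.comp_apply, cubeToPath_edgeChain h, pathBoundary_pair,
    cubeBoundary_edgeChain h, map_sub, cubeToPathZero, pointLift_pointChain]

/-- All 0-chains are allowed, so path cycles are just the allowed chains with zero boundary.
Injectivity in degree zero pulls the vanishing of the boundary back to cubes. -/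
theorem map_cubeCycles : (cubeCycles R G 1).map (cubeToPath R G) = pathCycles R G 1 := by
  rw [pathCycles_one, ← range_cubeToPath]
  ext y
  constructor
  · rintro ⟨x, hx, rfl⟩
    refine ⟨⟨x, rfl⟩, ?_⟩
    rw [SetLike.mem_coe, LinearMap.mem_ker, pathBoundary_cubeToPath,
      (LinearMap.mem_ker.1 hx : cubeBoundary R G 0 x = 0), map_zero]
  · rintro ⟨⟨x, rfl⟩, hx⟩
    refine ⟨x, ?_, rfl⟩
    rw [SetLike.mem_coe, LinearMap.mem_ker, pathBoundary_cubeToPath] at hx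
    exact LinearMap.mem_ker.2 (cubeToPathZero_injective (hx.trans (map_zero _).symm))

theorem cubeToPath_square {a b c d : V} (hab : WeakAdj G a b) (hbc : WeakAdj G b c)
    (had : WeakAdj G a d) (hdc : WeakAdj G d c) :
    cubeToPath R G (cubeBoundary R G 1 (squareChain R hab hbc had hdc)) =
      tupleChain R ![a, b] + tupleChain R ![b, c] - tupleChain R ![a, d] -
        tupleChain R ![d, c] := by
  rw [cubeBoundary_squareChain]
  simp only [map_add, map_sub, cubeToPath_edgeChain, hab, hbc, had, hdc]

/-- A square is cut along its diagonal into (a, b, c) and (a, d, c). Each triple alone may have a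
forbidden face (a, c); in the difference this face cancels. -/
theorem map_range_cubeBoundary_le :
    (LinearMap.range (cubeBoundary R G 1)).map (cubeToPath R G) ≤ pathBoundaries R G 1 := by
  rw [Submodule.map_le_iff_le_comap]
  refine range_cubeBoundary_one_le fun {a b c d} hab hbc had hdc => ?_
  have hmem := cubeToPath_square (R := R) hab hbc had hdc
  rw [cubeBoundary_squareChain] at hmem
  have hb : pathBoundary R V 1 (tupleChain R ![a, b, c] - tupleChain R ![a, d, c]) =
      cubeToPath R G (edgeChain R G a b + edgeChain R G b c - edgeChain R G a d -
        edgeChain R G d c) := by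
    rw [hmem, map_sub, pathBoundary_triple, pathBoundary_triple]
    abel
  refine ⟨_, ⟨sub_mem (triple_mem_allowed hab hbc) (triple_mem_allowed had hdc), ?_⟩, hb⟩
  rw [SetLike.mem_coe, Submodule.mem_comap]
  refine hb ▸ ?_
  rw [← range_cubeToPath]
  exact ⟨_, rfl⟩

-- An allowed 2-chain with allowed boundary need not split into pieces of the same kind that are
-- easy to list. Instead the boundary map is corrected on non-adjacent pairs so that each single
-- triple gives a square, and the correction vanishes on allowed boundaries.
open Classical in
theorem pathBoundaries_one_le :
    pathBoundaries R G 1 ≤ (LinearMap.range (cubeBoundary R G 1)).map (cubeToPath R G) := by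
  have hm : ∀ a c : V, ∃ m, (∃ b, WeakAdj G a b ∧ WeakAdj G b c) →
      WeakAdj G a m ∧ WeakAdj G m c := by
    intro a c
    by_cases h : ∃ b, WeakAdj G a b ∧ WeakAdj G b c
    · exact ⟨h.choose, fun _ => h.choose_spec⟩
    -- A junk value, for pairs that are not the ends of any walk of length two.
    · exact ⟨a, fun h' => (h h').elim⟩
  choose m hm using hm
  -- Adding φ replaces a forbidden pair (a, c) by the detour through the chosen midpoint and leaves
  -- allowed pairs alone.
  let φ : V → V → PathChain R V 1 := fun a c => if WeakAdj G a c then 0 else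
    tupleChain R ![a, m a c] + tupleChain R ![m a c, c] - tupleChain R ![a, c]
  have hφ : ∀ a, φ a a = 0 := fun a => if_pos (WeakAdj.refl a)
  have hr : ∀ x ∈ allowedPathChains R G 1, pairLift φ hφ x = 0 := by
    intro x hx
    rw [← range_cubeToPath] at hx
    obtain ⟨x, rfl⟩ := hx
    refine LinearMap.congr_fun (f := (pairLift φ hφ).comp (cubeToPath R G)) (g := 0)
      (cubeChain_hom_ext fun a b h => ?_) x
    rw [LinearMap.comp_apply, cubeToPath_edgeChain h, pairLift_pair]
    exact if_pos h
  have key : ∀ x ∈ allowedPathChains R G 2,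
      pathBoundary R V 1 x + pairLift φ hφ (pathBoundary R V 1 x) ∈
        (LinearMap.range (cubeBoundary R G 1)).map (cubeToPath R G) := by
    suffices allowedPathChains R G 2 ≤ ((LinearMap.range (cubeBoundary R G 1)).map
        (cubeToPath R G)).comap (pathBoundary R V 1 +
          (pairLift φ hφ).comp (pathBoundary R V 1)) from fun x hx => this hx
    rw [allowedPathChains, Submodule.span_le]
    rintro _ ⟨v, hv, rfl⟩
    obtain ⟨a, b, c, rfl⟩ : ∃ a b c, v = ![a, b, c] :=
      ⟨v 0, v 1, v 2, by funext i; fin_cases i <;> rfl⟩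
    have hab : WeakAdj G a b := Or.inr (hv 0)
    have hbc : WeakAdj G b c := Or.inr (hv 1)
    change pathBoundary R V 1 (tupleChain R _) +
      pairLift φ hφ (pathBoundary R V 1 (tupleChain R _)) ∈
        (LinearMap.range (cubeBoundary R G 1)).map (cubeToPath R G)
    rw [pathBoundary_triple, map_add, map_sub, hr _ (pair_mem_allowed hab),
      hr _ (pair_mem_allowed hbc), pairLift_pair]
    by_cases hac : WeakAdj G a c
    -- A triangle is the square a, b, c, a with one collapsed side.
    · refine ⟨_, ⟨squareChain R hab hbc (WeakAdj.refl a) hac, rfl⟩, ?_⟩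
      rw [cubeToPath_square, pair_self]
      simp only [φ, if_pos hac]
      abel
    · obtain ⟨h1, h2⟩ := hm a c ⟨b, hab, hbc⟩
      refine ⟨_, ⟨squareChain R hab hbc h1 h2, rfl⟩, ?_⟩
      rw [cubeToPath_square]
      simp only [φ, if_neg hac]
      abel
  rintro _ ⟨x, ⟨hx, hx'⟩, rfl⟩
  have := key x hx
  rwa [hr _ hx', add_zero] at this

/-- An injective linear map induces an isomorphism of a subquotient onto its image. -/
noncomputable def subquotientEquivMap {M N : Type*} [AddCommGroup M] [Module R M]
    [AddCommGroup N] [Module R N] (f : M →ₗ[R] N) (hf : Function.Injective f)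
    (K B : Submodule R M) :
    (K ⧸ B.submoduleOf K) ≃ₗ[R] (K.map f ⧸ (B.map f).submoduleOf (K.map f)) :=
  Submodule.Quotient.equiv _ _ (K.equivMapOfInjective f hf) (by
    ext ⟨y, hy⟩
    simp only [Submodule.mem_map, Submodule.submoduleOf, Submodule.mem_comap,
      Submodule.subtype_apply]
    constructor
    · rintro ⟨x, hx, h⟩
      exact ⟨x, hx, congrArg Subtype.val h⟩
    · rintro ⟨x, hx, rfl⟩
      obtain ⟨x', hx', h⟩ := hy
      obtain rfl := hf h
      exact ⟨⟨x', hx'⟩, hx, rfl⟩)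

theorem nonempty_cubeHomology_equiv_pathHomology (R : Type*) [CommRing R] (G : SimpleGraph V) :
    Nonempty (CubeHomology R G 1 ≃ₗ[R] PathHomology R G 1) := by
  have e := subquotientEquivMap (cubeToPath R G) cubeToPath_injective (cubeCycles R G 1)
    (LinearMap.range (cubeBoundary R G 1))
  rw [map_cubeCycles, le_antisymm map_range_cubeBoundary_le pathBoundaries_one_le] at e
  exact ⟨e⟩

end CubesAndPaths

/-! ### Telescoping sums over the integers. -/

section FiniteSums

variable {M : Type*} [AddCommGroup M]

theorem hasFiniteSupport_of_abs {u : ℤ → M} {N : ℕ} (h : ∀ i : ℤ, (N : ℤ) ≤ |i| → u i = 0) :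
    u.HasFiniteSupport := by
  refine (Set.finite_Icc (-(N : ℤ)) N).subset fun i hi => ?_
  have : ¬ (N : ℤ) ≤ |i| := fun h' => hi (h i h')
  exact abs_le.1 (not_le.1 this).le

theorem finsum_telescope {u : ℤ → M} {N : ℕ} {x : M} (h0 : ∀ i : ℤ, i ≤ -N → u i = 0)
    (h1 : ∀ i : ℤ, N ≤ i → u i = x) : ∑ᶠ i, (u (i + 1) - u i) = x := by
  have key : ∀ k : ℕ, ∑ i ∈ Finset.Ico (-(N : ℤ)) (-N + k), (u (i + 1) - u i) =
      u (-N + k) - u (-N) := by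
    intro k
    induction k with
    | zero => simp
    | succ k ih =>
      have : Finset.Ico (-(N : ℤ)) (-N + (k + 1 : ℕ)) =
          insert (-(N : ℤ) + k) (Finset.Ico (-(N : ℤ)) (-N + k)) := by
        ext i; simp only [Finset.mem_Ico, Finset.mem_insert]; omega
      rw [this, Finset.sum_insert (by simp), ih]
      push_cast
      rw [← add_assoc]
      abel
  rw [finsum_eq_sum_of_support_subset (s := Finset.Ico (-(N : ℤ)) (-N + (2 * N : ℕ))), key,
    h0 _ le_rfl, h1 _ (by omega), sub_zero]
  intro i hi
  rw [Finset.mem_coe, Finset.mem_Ico]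
  by_contra h
  refine hi ?_
  rcases lt_or_ge i (-(N : ℤ)) with h' | h'
  · simp only [h0 i (by omega), h0 (i + 1) (by omega), sub_zero]
  · simp only [h1 i (by omega), h1 (i + 1) (by omega), sub_self]

end FiniteSums

/-! ### The discrete Hurewicz theorem in degree one. -/

section Hurewicz

variable {V : Type*} {G : SimpleGraph V} {v₀ : V} {R : Type*} [CommRing R]

/-! ### Systems of paths to the base point -/

theorem Loop.weakAdj (f : Loop G v₀) (i : ℤ) : WeakAdj G (f i) (f (i + 1)) :=
  f.map_adj _ _ (Or.inl rfl)

/-- A discrete loop from its sequence of vertices. -/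
def Loop.ofSteps (u : ℤ → V) (hu : ∀ i, WeakAdj G (u i) (u (i + 1)))
    (hs : ∃ N : ℕ, ∀ i : ℤ, N ≤ i → u i = v₀ ∧ u (-i) = v₀) : Loop G v₀ where
  toFun := u
  map_adj := by
    rintro i j (rfl | rfl)
    · exact hu i
    · exact (hu j).symm
  stable := by
    obtain ⟨N, hN⟩ := hs
    refine ⟨N, fun i hi => ?_⟩
    rcases abs_cases i with ⟨h, -⟩ | ⟨h, -⟩
    · exact (hN i (h ▸ hi)).1
    · simpa using (hN (-i) (h ▸ hi)).2

/-- For every vertex a discrete path that starts there at time `0` and ends at `v₀`. -/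
structure PathSystem (G : SimpleGraph V) (v₀ : V) where
  toFun : V → ℤ → V
  eq_of_nonpos : ∀ a i, i ≤ 0 → toFun a i = a
  weakAdj : ∀ a i, WeakAdj G (toFun a i) (toFun a (i + 1))
  stable : ∀ a, ∃ N : ℕ, ∀ i : ℤ, N ≤ i → toFun a i = v₀
  base : ∀ i, toFun v₀ i = v₀

instance : CoeFun (PathSystem G v₀) (fun _ => V → ℤ → V) := ⟨PathSystem.toFun⟩

theorem _root_.SimpleGraph.Connected.nonempty_pathSystem (h : G.Connected) (v₀ : V) :
    Nonempty (PathSystem G v₀) := by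
  classical
  -- The walk at the base point must be trivial, so that cutting a loop outside its support changes
  -- nothing.
  have hw : ∀ a, ∃ w : G.Walk a v₀, ∀ n, a = v₀ → w.getVert n = v₀ := by
    intro a
    by_cases ha : a = v₀
    · subst ha
      exact ⟨.nil, fun n _ => rfl⟩
    · obtain ⟨w⟩ := h.preconnected a v₀
      exact ⟨w, fun _ h' => (ha h').elim⟩
  choose w hw using hw
  refine ⟨⟨fun a i => (w a).getVert i.toNat, fun a i hi => ?_, fun a i => ?_, fun a => ?_,
    fun i => hw _ _ rfl⟩⟩
  · simp only [Int.toNat_of_nonpos hi, SimpleGraph.Walk.getVert_zero]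
  · rcases lt_or_ge i 0 with hi | hi
    · left
      simp only [Int.toNat_of_nonpos hi.le, Int.toNat_of_nonpos (by omega : i + 1 ≤ 0)]
    · have : (i + 1).toNat = i.toNat + 1 := by omega
      simp only [this]
      rcases lt_or_ge i.toNat (w a).length with hl | hl
      · exact Or.inr ((w a).adj_getVert_succ hl)
      · left
        rw [(w a).getVert_of_length_le hl, (w a).getVert_of_length_le (by omega)]
  · exact ⟨(w a).length, fun i hi => (w a).getVert_of_length_le (by omega)⟩

namespace PathSystem

variable (p : PathSystem G v₀)

theorem weakAdj_of_close (a : V) {i j : ℤ} (h1 : i ≤ j + 1) (h2 : j ≤ i + 1) :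
    WeakAdj G (p a i) (p a j) := by
  obtain rfl | rfl | rfl : j = i ∨ j = i + 1 ∨ i = j + 1 := by omega
  · exact .refl _
  · exact p.weakAdj _ _
  · exact (p.weakAdj _ _).symm

/-- Follow the loop `f` up to time `n`, then the chosen path to the base point. -/
def cut (f : Loop G v₀) (n : ℤ) : Loop G v₀ :=
  Loop.ofSteps (fun i => if i ≤ n then f i else p (f n) (i - n)) (by
    intro i
    rcases lt_trichotomy i n with h | rfl | h
    · rw [if_pos h.le, if_pos (by omega)]
      exact f.weakAdj i
    · rw [if_pos le_rfl, if_neg (by omega)]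
      simpa [p.eq_of_nonpos] using p.weakAdj (f i) 0
    · rw [if_neg (by omega), if_neg (by omega)]
      exact p.weakAdj_of_close _ (by omega) (by omega)) (by
    obtain ⟨N, hN⟩ := p.stable (f n)
    refine ⟨n.natAbs + N + f.radius + 1, fun i hi => ⟨?_, ?_⟩⟩
    · rw [if_neg (by omega)]
      exact hN _ (by omega)
    · rw [if_pos (by omega)]
      exact f.eq_left _ (by omega))

theorem cut_apply (f : Loop G v₀) (n i : ℤ) :
    p.cut f n i = if i ≤ n then f i else p (f n) (i - n) := rfl

/-- With `cut_of_ge`, this gives the two ends of the telescoping product that decomposes a loop: cut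
early it is constant, cut late it is the loop itself. -/
theorem cut_of_le (f : Loop G v₀) {n : ℤ} (h : n ≤ -f.radius) : p.cut f n = .const G v₀ := by
  apply Loop.ext_fun
  intro i
  rw [cut_apply]
  split_ifs
  · exact f.eq_left _ (by omega)
  · rw [f.eq_left _ h, p.base]
    rfl

theorem cut_of_ge (f : Loop G v₀) {n : ℤ} (h : f.radius ≤ n) : p.cut f n = f := by
  apply Loop.ext_fun
  intro i
  rw [cut_apply]
  split_ifs
  · rfl
  · rw [f.eq_right _ h, p.base, f.eq_right _ (by omega)]

/-- The loop through the edge from `a` to `b`, closed up by the chosen paths. -/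
def bridge {a b : V} (h : WeakAdj G a b) : Loop G v₀ :=
  Loop.ofSteps (fun i => if i ≤ 0 then p a (-i) else p b (i - 1)) (by
    intro i
    rcases lt_trichotomy i 0 with h' | rfl | h'
    · rw [if_pos h'.le, if_pos (by omega)]
      exact p.weakAdj_of_close _ (by omega) (by omega)
    · simpa [p.eq_of_nonpos] using h
    · rw [if_neg (by omega), if_neg (by omega)]
      exact p.weakAdj_of_close _ (by omega) (by omega)) (by
    obtain ⟨N, hN⟩ := p.stable a
    obtain ⟨M, hM⟩ := p.stable b
    refine ⟨N + M + 1, fun i hi => ⟨?_, ?_⟩⟩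
    · rw [if_neg (by omega)]
      exact hM _ (by omega)
    · rw [if_pos (by omega)]
      exact hN _ (by omega))

theorem bridge_apply {a b : V} (h : WeakAdj G a b) (i : ℤ) :
    p.bridge h i = if i ≤ 0 then p a (-i) else p b (i - 1) := rfl

/-- The loop through the vertices `a`, `b`, `c`, closed up by the chosen paths. -/
def bridge₂ {a b c : V} (hab : WeakAdj G a b) (hbc : WeakAdj G b c) : Loop G v₀ :=
  Loop.ofSteps (fun i => if i ≤ 1 then p.bridge hab i else p c (i - 2)) (by
    intro i
    rcases lt_trichotomy i 1 with h' | rfl | h'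
    · rw [if_pos h'.le, if_pos (by omega)]
      exact (p.bridge hab).weakAdj i
    · simpa [p.eq_of_nonpos, bridge_apply] using hbc
    · rw [if_neg (by omega), if_neg (by omega)]
      exact p.weakAdj_of_close _ (by omega) (by omega)) (by
    obtain ⟨N, hN⟩ := p.stable c
    refine ⟨N + (p.bridge hab).radius + 2, fun i hi => ⟨?_, ?_⟩⟩
    · rw [if_neg (by omega)]
      exact hN _ (by omega)
    · rw [if_pos (by omega)]
      exact Loop.eq_left _ _ (by omega))

theorem bridge₂_apply {a b c : V} (hab : WeakAdj G a b) (hbc : WeakAdj G b c) (i : ℤ) :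
    p.bridge₂ hab hbc i = if i ≤ 1 then p.bridge hab i else p c (i - 2) := rfl

end PathSystem

/-! ### Pauses in a loop, and splitting off one step. -/

/-- Repeat the value of a loop at time `n`. -/
def Loop.stutter (f : Loop G v₀) (n : ℤ) : Loop G v₀ :=
  Loop.ofSteps (fun i => if i ≤ n then f i else f (i - 1)) (by
    intro i
    rcases lt_trichotomy i n with h' | rfl | h'
    · rw [if_pos h'.le, if_pos (by omega)]
      exact f.weakAdj i
    · rw [if_pos le_rfl, if_neg (by omega), add_sub_cancel_right]
      exact .refl _
    · rw [if_neg (by omega), if_neg (by omega)]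
      convert f.weakAdj (i - 1) using 2
      ring) (by
    refine ⟨n.natAbs + f.radius + 1, fun i hi => ⟨?_, ?_⟩⟩
    · rw [if_neg (by omega)]
      exact f.eq_right _ (by omega)
    · rw [if_pos (by omega)]
      exact f.eq_left _ (by omega))

theorem Loop.stutter_apply (f : Loop G v₀) (n i : ℤ) :
    f.stutter n i = if i ≤ n then f i else f (i - 1) := rfl

/-- At each time the two loops differ by a delay of at most one, so a pause costs one homotopy step.
-/
theorem Loop.stutter_near (f : Loop G v₀) (n : ℤ) : Near (f.stutter n) f := by
  intro i
  rw [stutter_apply]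
  split_ifs
  · exact Or.inl rfl
  · have := f.weakAdj (i - 1)
    rwa [sub_add_cancel] at this

/-- A pause of length k at time n is k successive stutters there. -/
theorem Loop.homotopic_wait (f : Loop G v₀) (n : ℤ) (k : ℕ) {g : Loop G v₀}
    (hg : ∀ i, g i = f (if i ≤ n then i else max n (i - k))) : Homotopic f g := by
  obtain ⟨h, hh, he⟩ : ∃ h : Loop G v₀, Homotopic f h ∧
      ∀ i, h i = f (if i ≤ n then i else max n (i - k)) := by
    clear hg
    induction k with
    | zero =>
      refine ⟨f, .refl f, fun i => ?_⟩
      congr 1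
      split_ifs <;> push_cast <;> omega
    | succ k ih =>
      obtain ⟨h, hh, he⟩ := ih
      refine ⟨h.stutter n, hh.step (h.stutter_near n).symm, fun i => ?_⟩
      rw [stutter_apply, he, he]
      split_ifs <;> first | rfl | (congr 1; push_cast; omega)
  rwa [Loop.ext_fun fun i => (hg i).trans (he i).symm]

namespace PathSystem

variable (p : PathSystem G v₀)

/-- The concatenation follows f up to n, runs to the base point and back along the chosen path of f
n, then crosses to f (n + 1) and goes home. The excursion there and back contracts. -/
theorem cut_succ (f : Loop G v₀) (n : ℤ) :
    Homotopic (p.cut f (n + 1)) ((p.cut f n).concat (p.bridge (f.weakAdj n))) := by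
  obtain ⟨M, hM⟩ := p.stable (f n)
  have hf : ∀ i, n + M ≤ i → p.cut f n i = v₀ := by
    intro i hi
    rw [cut_apply]
    split_ifs with h
    · have h' := hM 0 (by omega)
      rwa [p.eq_of_nonpos _ _ le_rfl, show n = i by omega] at h'
    · exact hM _ (by omega)
  have hg : ∀ i, i ≤ n + M - (n + 2 * M) → p.bridge (f.weakAdj n) i = v₀ := by
    intro i hi
    rw [bridge_apply, if_pos (by omega)]
    exact hM _ (by omega)
  refine Homotopic.trans ?_ (concat_homotopic_glue _ _ (n + M) (n + 2 * M) hf hg).symm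
  -- The excursion takes place in a window of length 2M after n and goes to depth at most j. For j =
  -- 0 it is a pause; for j = M it is the full excursion, which reaches the base point at time n +
  -- M.
  let X : ℕ → Loop G v₀ := fun j => Loop.ofSteps (fun i => if i ≤ n then f i else
      if i ≤ n + 2 * M then p (f n) (min (min (i - n) (n + 2 * M - i)) j)
      else p.cut f (n + 1) (i - 2 * M)) (by
    intro i
    rcases lt_or_ge i n with h | h
    · rw [if_pos h.le, if_pos (by omega)]
      exact f.weakAdj i
    -- At i = n the first two branches agree, since the chosen path starts at f n; this merges the
    -- junction with the window.
    have e1 : (if i ≤ n then f i else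
        if i ≤ n + 2 * M then p (f n) (min (min (i - n) (n + 2 * M - i)) j)
        else p.cut f (n + 1) (i - 2 * M)) = if i ≤ n + 2 * M then
          p (f n) (min (min (i - n) (n + 2 * M - i)) j) else p.cut f (n + 1) (i - 2 * M) := by
      split_ifs with h1 h2
      · obtain rfl : i = n := by omega
        rw [p.eq_of_nonpos _ _ (by omega)]
      · omega
      · rfl
      · rfl
    rw [e1, if_neg (show ¬ i + 1 ≤ n by omega)]
    rcases lt_trichotomy i (n + 2 * M) with h' | h' | h'
    · rw [if_pos h'.le, if_pos (by omega)]
      exact p.weakAdj_of_close _ (by omega) (by omega)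
    · rw [if_pos h'.le, if_neg (by omega), p.eq_of_nonpos _ _ (by omega), cut_apply,
        if_pos (by omega), h']
      convert f.weakAdj n using 2
      ring
    · rw [if_neg (by omega), if_neg (by omega)]
      convert (p.cut f (n + 1)).weakAdj (i - 2 * M) using 2
      ring) (by
    refine ⟨(p.cut f (n + 1)).radius + f.radius + n.natAbs + 2 * M + 1, fun i hi => ⟨?_, ?_⟩⟩
    · rw [if_neg (by omega), if_neg (by omega)]
      exact Loop.eq_right _ _ (by omega)
    · rw [if_pos (by omega)]
      exact Loop.eq_left _ _ (by omega))
  have hX : ∀ j i, X j i = if i ≤ n then f i else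
      if i ≤ n + 2 * M then p (f n) (min (min (i - n) (n + 2 * M - i)) j)
      else p.cut f (n + 1) (i - 2 * M) := fun _ _ => rfl
  have h0 : Homotopic (p.cut f (n + 1)) (X 0) := by
    refine Loop.homotopic_wait _ n (2 * M) fun i => ?_
    rw [hX]
    split_ifs with h1 h2
    · rw [cut_apply, if_pos (by omega)]
    · rw [p.eq_of_nonpos _ _ (by simp), cut_apply, if_pos (by push_cast; omega)]
      congr 1; push_cast; omega
    · congr 1; push_cast; omega
  have hstep : ∀ j, Homotopic (p.cut f (n + 1)) (X j) := by
    intro j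
    induction j with
    | zero => exact h0
    | succ j ih =>
      refine ih.step fun i => ?_
      -- Raising the depth bound by one moves each position along the chosen path by at most one.
      rw [hX, hX]
      split_ifs
      · exact Or.inl rfl
      · exact p.weakAdj_of_close _ (by push_cast; omega) (by push_cast; omega)
      · exact Or.inl rfl
  have hM' : X M = glue (p.cut f n) (p.bridge (f.weakAdj n)) (n + M) (n + 2 * M) hf hg := by
    apply Loop.ext_fun
    intro i
    rw [hX]
    simp only [glue]
    split_ifs with h1 h2 h3 h4 h5
    · rw [cut_apply, if_pos h1]
    · omega
    · rw [cut_apply, if_neg h1]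
      congr 1; omega
    · rw [bridge_apply, if_pos (by omega)]
      congr 1; omega
    · omega
    · rw [bridge_apply, if_neg (by omega), cut_apply]
      split_ifs with h6
      · have : i - 2 * M = n + 1 := by omega
        rw [this, p.eq_of_nonpos _ _ (by omega)]
      · congr 1; ring
  rw [← hM']
  exact hstep M

end PathSystem

/-! ### Weights of edges in the abelianized group. -/

/-- The class of a loop. -/
def A1.mk (f : Loop G v₀) : A1 G v₀ := Quotient.mk (loopSetoid G v₀) f

theorem A1.sound {f g : Loop G v₀} (h : Homotopic f g) : A1.mk f = A1.mk g := Quotient.sound h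

theorem A1.mk_concat (f g : Loop G v₀) : A1.mk (f.concat g) = A1.mk f * A1.mk g := rfl

theorem A1.mk_const : A1.mk (Loop.const G v₀) = 1 := rfl

/-- The class of a loop in the abelianized fundamental group, written additively. -/
noncomputable def abClass (x : A1 G v₀) : Additive (Abelianization (A1 G v₀)) :=
  Additive.ofMul (Abelianization.of x)

theorem abClass_mul (x y : A1 G v₀) :
    abClass (x * y) = abClass x + abClass y := by
  simp [abClass]

theorem abClass_one : abClass (1 : A1 G v₀) = 0 := by
  simp [abClass]

namespace PathSystem

variable (p : PathSystem G v₀)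

/-- This is `cut_succ` at time 1, where the loop stands at b: cut there it is the loop of the first
edge, and cut one step later it is unchanged. -/
theorem mk_bridge₂ {a b c : V} (hab : WeakAdj G a b) (hbc : WeakAdj G b c) :
    A1.mk (p.bridge₂ hab hbc) = A1.mk (p.bridge hab) * A1.mk (p.bridge hbc) := by
  have h := p.cut_succ (p.bridge₂ hab hbc) 1
  have e1 : p.bridge₂ hab hbc 1 = b := by
    rw [bridge₂_apply, if_pos le_rfl, bridge_apply, if_neg (by omega),
      p.eq_of_nonpos _ _ (by omega)]
  have e2 : p.bridge₂ hab hbc (1 + 1) = c := by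
    rw [bridge₂_apply, if_neg (by omega), p.eq_of_nonpos _ _ (by omega)]
  have h1 : p.cut (p.bridge₂ hab hbc) 1 = p.bridge hab := by
    apply Loop.ext_fun
    intro i
    rw [cut_apply]
    split_ifs with hi
    · rw [bridge₂_apply, if_pos hi]
    · rw [e1, bridge_apply, if_neg (by omega)]
  have h2 : p.cut (p.bridge₂ hab hbc) (1 + 1) = p.bridge₂ hab hbc := by
    apply Loop.ext_fun
    intro i
    rw [cut_apply]
    split_ifs with hi
    · rfl
    · rw [e2, bridge₂_apply, if_neg (by omega)]
      rfl
  have h3 : p.bridge ((p.bridge₂ hab hbc).weakAdj 1) = p.bridge hbc := by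
    apply Loop.ext_fun
    intro i
    rw [bridge_apply, bridge_apply, e1, e2]
  rw [h1, h2, h3] at h
  exact A1.sound h

/-- Opposite corners b and d need not be adjacent, so the loops are first put out of phase: a, b, c,
c against a, a, d, c. These agree or are adjacent at every time. -/
theorem bridge₂_homotopic {a b c d : V} (hab : WeakAdj G a b) (hbc : WeakAdj G b c)
    (had : WeakAdj G a d) (hdc : WeakAdj G d c) :
    Homotopic (p.bridge₂ hab hbc) (p.bridge₂ had hdc) := by
  refine (((Loop.stutter_near _ 2).symm.homotopic).step (k := (p.bridge₂ had hdc).stutter 0)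
    fun i => ?_).step (Loop.stutter_near _ 0)
  simp only [Loop.stutter_apply, bridge₂_apply, bridge_apply]
  rcases le_or_gt i 0 with h | h
  · left
    rw [if_pos (by omega), if_pos (by omega), if_pos h, if_pos h, if_pos (by omega), if_pos h]
  obtain rfl | rfl | h : i = 1 ∨ i = 2 ∨ 3 ≤ i := by omega
  · simpa [p.eq_of_nonpos, WeakAdj] using hab.symm
  · simpa [p.eq_of_nonpos, WeakAdj] using hdc.symm
  · left
    rw [if_neg (by omega), if_neg (by omega), if_neg (by omega), if_neg (by omega)]

/-- The class is idempotent: the loop through a, a, a is both its square and the same loop with one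
pause. -/
theorem mk_bridge_self (a : V) : A1.mk (p.bridge (WeakAdj.refl a)) = 1 := by
  have h : A1.mk (p.bridge₂ (WeakAdj.refl a) (WeakAdj.refl a)) =
      A1.mk (p.bridge (WeakAdj.refl a)) := by
    have e : p.bridge₂ (WeakAdj.refl a) (WeakAdj.refl a) =
        (p.bridge (WeakAdj.refl a)).stutter 0 := by
      apply Loop.ext_fun
      intro i
      simp only [Loop.stutter_apply, bridge₂_apply, bridge_apply]
      rcases le_or_gt i 0 with h | h
      · rw [if_pos (by omega), if_pos h]
        simp [h]
      obtain rfl | h : i = 1 ∨ 2 ≤ i := by omega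
      · simp [p.eq_of_nonpos]
      · rw [if_neg (by omega), if_neg (by omega), if_neg (by omega)]
        congr 1
        ring
    rw [e]
    exact A1.sound (Loop.stutter_near _ 0).homotopic
  rwa [mk_bridge₂, mul_eq_left] at h

open Classical in
/-- The class in the abelianized fundamental group attached to a pair of vertices. -/
noncomputable def weight (a b : V) : Additive (Abelianization (A1 G v₀)) :=
  if h : WeakAdj G a b then abClass (A1.mk (p.bridge h)) else 0

theorem weight_of_weakAdj {a b : V} (h : WeakAdj G a b) :
    p.weight a b = abClass (A1.mk (p.bridge h)) := dif_pos h

theorem weight_self (a : V) : p.weight a a = 0 := by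
  rw [p.weight_of_weakAdj (.refl a), mk_bridge_self, abClass_one]

theorem weight_square {a b c d : V} (hab : WeakAdj G a b) (hbc : WeakAdj G b c)
    (had : WeakAdj G a d) (hdc : WeakAdj G d c) :
    p.weight a b + p.weight b c = p.weight a d + p.weight d c := by
  rw [p.weight_of_weakAdj hab, p.weight_of_weakAdj hbc, p.weight_of_weakAdj had,
    p.weight_of_weakAdj hdc, ← abClass_mul, ← abClass_mul, ← mk_bridge₂, ← mk_bridge₂,
    A1.sound (p.bridge₂_homotopic hab hbc had hdc)]

/-- By `cut_succ` each weight is the difference of the classes of two consecutive cuts, so the sum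
telescopes from the constant loop to f. -/
theorem finsum_weight (f : Loop G v₀) :
    ∑ᶠ i, p.weight (f i) (f (i + 1)) = abClass (A1.mk f) := by
  have h : ∀ i, p.weight (f i) (f (i + 1)) =
      abClass (A1.mk (p.cut f (i + 1))) - abClass (A1.mk (p.cut f i)) := by
    intro i
    rw [A1.sound (p.cut_succ f i), A1.mk_concat, abClass_mul, add_sub_cancel_left,
      p.weight_of_weakAdj (f.weakAdj i)]
  rw [finsum_congr h]
  refine finsum_telescope (u := fun i => abClass (A1.mk (p.cut f i))) (N := f.radius)
    (fun i hi => ?_) (fun i hi => ?_)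
  · simp only [p.cut_of_le f hi, A1.mk_const, abClass_one]
  · simp only [p.cut_of_ge f hi]

end PathSystem

/-! ### The Hurewicz isomorphism -/

/-- The cokernel of the boundary map on 2-chains. -/
abbrev CubeCokernel (R : Type*) [CommRing R] (G : SimpleGraph V) :=
  CubeChain R G 1 ⧸ LinearMap.range (cubeBoundary R G 1)

/-- The class of a pair of vertices modulo boundaries. -/
noncomputable def edgeClass (R : Type*) [CommRing R] (G : SimpleGraph V) (a b : V) :
    CubeCokernel R G := Submodule.Quotient.mk (edgeChain R G a b)

theorem edgeClass_self (a : V) : edgeClass R G a a = 0 := by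
  rw [edgeClass, edgeChain_self, Submodule.Quotient.mk_zero]

theorem edgeClass_square {a b c d : V} (hab : WeakAdj G a b) (hbc : WeakAdj G b c)
    (had : WeakAdj G a d) (hdc : WeakAdj G d c) :
    edgeClass R G a b + edgeClass R G b c = edgeClass R G a d + edgeClass R G d c := by
  simp only [edgeClass, ← Submodule.Quotient.mk_add]
  rw [Submodule.Quotient.eq, ← sub_sub]
  exact ⟨_, cubeBoundary_squareChain hab hbc had hdc⟩

/-- The square a, b, a, a shows that going forth and back is a boundary. -/
theorem edgeClass_symm {a b : V} (h : WeakAdj G a b) :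
    edgeClass R G b a = -edgeClass R G a b := by
  have := edgeClass_square (R := R) h h.symm (.refl a) (.refl a)
  rw [edgeClass_self, add_zero] at this
  exact eq_neg_of_add_eq_zero_right this

theorem cubeCokernel_hom_ext {M : Type*} [AddCommGroup M] [Module R M]
    {f g : CubeCokernel R G →ₗ[R] M}
    (h : ∀ a b, WeakAdj G a b → f (edgeClass R G a b) = g (edgeClass R G a b)) : f = g :=
  Submodule.linearMap_qext _ (cubeChain_hom_ext h)

/-- The boundary map on the cokernel. -/
noncomputable def cokernelBoundary (R : Type*) [CommRing R] (G : SimpleGraph V) :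
    CubeCokernel R G →ₗ[R] CubeChain R G 0 :=
  (LinearMap.range (cubeBoundary R G 1)).liftQ (cubeBoundary R G 0)
    (range_cubeBoundary_one_le fun hab hbc had hdc => by
      simp only [LinearMap.mem_ker, map_add, map_sub, cubeBoundary_edgeChain, hab, hbc, had, hdc]
      abel)

theorem cokernelBoundary_edgeClass {a b : V} (h : WeakAdj G a b) :
    cokernelBoundary R G (edgeClass R G a b) = pointChain R G b - pointChain R G a := by
  rw [cokernelBoundary, edgeClass, Submodule.liftQ_apply, cubeBoundary_edgeChain h]

/-- The class of the 1-cycle of a loop. -/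
noncomputable def Loop.chainClass (R : Type*) [CommRing R] (f : Loop G v₀) : CubeCokernel R G :=
  ∑ᶠ i, edgeClass R G (f i) (f (i + 1))

theorem Loop.hasFiniteSupport {M : Type*} [AddCommGroup M] (f : Loop G v₀) {φ : V → V → M}
    (hφ : ∀ a, φ a a = 0) : (fun i => φ (f i) (f (i + 1))).HasFiniteSupport := by
  refine hasFiniteSupport_of_abs (N := f.radius + 1) fun i hi => ?_
  rcases abs_cases i with ⟨h, -⟩ | ⟨h, -⟩
  · simp only [f.eq_right i (by omega), f.eq_right (i + 1) (by omega), hφ]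
  · simp only [f.eq_left i (by omega), f.eq_left (i + 1) (by omega), hφ]

/-- The two loops bound a strip of squares with rungs from f i to g i. The difference of the edges
at time i is a difference of consecutive rungs, and the rungs are trivial far out. -/
theorem Near.chainClass_eq {f g : Loop G v₀} (h : Near f g) :
    f.chainClass R = g.chainClass R := by
  rw [← sub_eq_zero, Loop.chainClass, Loop.chainClass,
    ← finsum_sub_distrib (f.hasFiniteSupport edgeClass_self) (g.hasFiniteSupport edgeClass_self)]
  have h1 : ∀ i, edgeClass R G (f i) (f (i + 1)) - edgeClass R G (g i) (g (i + 1)) =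
      -edgeClass R G (f (i + 1)) (g (i + 1)) - -edgeClass R G (f i) (g i) := by
    intro i
    have := edgeClass_square (R := R) (f.weakAdj i) (h (i + 1)) (h i) (g.weakAdj i)
    rw [sub_neg_eq_add, sub_eq_iff_eq_add, add_assoc, ← this]
    abel
  rw [finsum_congr h1]
  refine finsum_telescope (u := fun i => -edgeClass R G (f i) (g i)) (N := f.radius + g.radius)
    (fun i hi => ?_) (fun i hi => ?_)
  · simp only [f.eq_left i (by omega), g.eq_left i (by omega), edgeClass_self, neg_zero]
  · simp only [f.eq_right i (by omega), g.eq_right i (by omega), edgeClass_self, neg_zero]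

theorem Homotopic.chainClass_eq {f g : Loop G v₀} (h : Homotopic f g) :
    f.chainClass R = g.chainClass R := by
  rw [homotopic_iff] at h
  induction h with
  | refl => rfl
  | tail _ hs ih => exact ih.trans hs.chainClass_eq

theorem finsum_comp_sub {M : Type*} [AddCommMonoid M] (u : ℤ → M) (c : ℤ) :
    ∑ᶠ i, u (i - c) = ∑ᶠ i, u i := finsum_comp_equiv (Equiv.subRight c)

/-- At each time at least one of f and the shifted g stays at the base point, so the edge of the
concatenation is the sum of their edges. At the junction, time `f.radius`, it is the edge of g that
counts. -/
theorem Loop.chainClass_concat (f g : Loop G v₀) :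
    (f.concat g).chainClass R = f.chainClass R + g.chainClass R := by
  obtain ⟨c, hc⟩ : ∃ c : ℤ, c = f.radius + g.radius := ⟨_, rfl⟩
  have hg : (fun i => edgeClass R G (g (i - c)) (g (i - c + 1))).HasFiniteSupport :=
    .comp_of_injective (f := fun i => edgeClass R G (g i) (g (i + 1)))
      (Equiv.subRight c).injective (g.hasFiniteSupport edgeClass_self)
  rw [Loop.chainClass, Loop.chainClass, Loop.chainClass,
    ← finsum_comp_sub (fun i => edgeClass R G (g i) (g (i + 1))) c,
    ← finsum_add_distrib (f.hasFiniteSupport edgeClass_self) hg]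
  refine finsum_congr fun i => ?_
  simp only [Loop.concat, glue, ← hc]
  have e : i - c + 1 = i + 1 - c := by ring
  rw [e]
  rcases lt_trichotomy i f.radius with h | h | h
  · rw [if_pos h.le, if_pos (by omega), g.eq_left (i - c) (by omega),
      g.eq_left (i + 1 - c) (by omega), edgeClass_self, add_zero]
  · rw [if_pos h.le, if_neg (by omega), f.eq_right i h.ge, f.eq_right (i + 1) (by omega),
      g.eq_left (i - c) (by omega), edgeClass_self, zero_add]
  · rw [if_neg (by omega), if_neg (by omega), f.eq_right i (by omega),
      f.eq_right (i + 1) (by omega), edgeClass_self, zero_add]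

theorem cokernelBoundary_chainClass (f : Loop G v₀) :
    cokernelBoundary R G (f.chainClass R) = 0 := by
  have h : ∀ i, cokernelBoundary R G (edgeClass R G (f i) (f (i + 1))) =
      (pointChain R G (f (i + 1)) - pointChain R G v₀) -
        (pointChain R G (f i) - pointChain R G v₀) := by
    intro i
    rw [cokernelBoundary_edgeClass (f.weakAdj i)]
    abel
  rw [Loop.chainClass, map_finsum _ (f.hasFiniteSupport edgeClass_self), finsum_congr h]
  refine finsum_telescope (u := fun i => pointChain R G (f i) - pointChain R G v₀)
    (N := f.radius) (fun i hi => ?_) (fun i hi => ?_)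
  · simp only [f.eq_left i hi, sub_self]
  · simp only [f.eq_right i hi, sub_self]

/-- The homomorphism that sends a loop to the class of its 1-cycle. -/
noncomputable def chainHom (R : Type*) [CommRing R] (G : SimpleGraph V) (v₀ : V) :
    A1 G v₀ →* Multiplicative (CubeCokernel R G) :=
  MonoidHom.mk' (Quotient.lift (fun f => Multiplicative.ofAdd (f.chainClass R))
    fun _ _ h => congrArg Multiplicative.ofAdd (Homotopic.chainClass_eq h)) (by
      rintro ⟨f⟩ ⟨g⟩
      exact congrArg Multiplicative.ofAdd (Loop.chainClass_concat f g))

/-- The Hurewicz map with values in the cokernel. -/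
noncomputable def hurewicz (R : Type*) [CommRing R] (G : SimpleGraph V) (v₀ : V) :
    R ⊗[ℤ] Additive (Abelianization (A1 G v₀)) →ₗ[R] CubeCokernel R G :=
  (MonoidHom.toAdditiveLeft
    (Abelianization.lift (chainHom R G v₀))).toIntLinearMap.liftBaseChange R

theorem hurewicz_one_tmul (f : Loop G v₀) :
    hurewicz R G v₀ (1 ⊗ₜ abClass (A1.mk f)) = f.chainClass R := by
  rw [hurewicz, LinearMap.liftBaseChange_one_tmul]
  rfl

theorem hurewicz_hom_ext {M : Type*} [AddCommGroup M] [Module R M]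
    {f g : R ⊗[ℤ] Additive (Abelianization (A1 G v₀)) →ₗ[R] M}
    (h : ∀ l : Loop G v₀, f (1 ⊗ₜ abClass (A1.mk l)) = g (1 ⊗ₜ abClass (A1.mk l))) : f = g := by
  refine TensorProduct.AlgebraTensorModule.curry_injective (LinearMap.ext_ring ?_)
  ext x
  obtain ⟨y, hy⟩ := QuotientGroup.mk_surjective (Additive.toMul x)
  induction y using Quotient.inductionOn with
  | h l =>
    have hx : x = abClass (A1.mk l) := congrArg Additive.ofMul hy.symm
    rw [hx]
    exact h l

namespace PathSystem

variable (p : PathSystem G v₀)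

/-- The inverse of the Hurewicz map on cycles. -/
noncomputable def weightHom (R : Type*) [CommRing R] :
    CubeCokernel R G →ₗ[R] R ⊗[ℤ] Additive (Abelianization (A1 G v₀)) :=
  (LinearMap.range (cubeBoundary R G 1)).liftQ
    (cubeLift G (fun a b => 1 ⊗ₜ p.weight a b) fun a => by
      rw [weight_self, TensorProduct.tmul_zero])
    (range_cubeBoundary_one_le fun hab hbc had hdc => by
      simp only [LinearMap.mem_ker, map_add, map_sub, cubeLift_edgeChain, hab, hbc, had, hdc]
      rw [← TensorProduct.tmul_add, p.weight_square hab hbc had hdc, TensorProduct.tmul_add]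
      abel)

theorem weightHom_edgeClass {a b : V} (h : WeakAdj G a b) :
    p.weightHom R (edgeClass R G a b) = 1 ⊗ₜ p.weight a b := by
  rw [weightHom, edgeClass, Submodule.liftQ_apply, cubeLift_edgeChain _ h]

/-- On the class of a loop this is `finsum_weight`. -/
theorem weightHom_hurewicz (x : R ⊗[ℤ] Additive (Abelianization (A1 G v₀))) :
    p.weightHom R (hurewicz R G v₀ x) = x := by
  refine LinearMap.congr_fun (f := (p.weightHom R).comp (hurewicz R G v₀)) (g := LinearMap.id)
    (hurewicz_hom_ext fun f => ?_) x
  rw [LinearMap.comp_apply, hurewicz_one_tmul, Loop.chainClass,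
    map_finsum _ (f.hasFiniteSupport edgeClass_self),
    finsum_congr fun i => p.weightHom_edgeClass (f.weakAdj i), LinearMap.id_apply,
    ← p.finsum_weight f]
  exact (map_finsum (TensorProduct.mk ℤ R (Additive (Abelianization (A1 G v₀))) 1)
    (f.hasFiniteSupport p.weight_self)).symm

theorem hasFiniteSupport (a : V) :
    (fun i => edgeClass R G (p a i) (p a (i + 1))).HasFiniteSupport := by
  obtain ⟨N, hN⟩ := p.stable a
  refine hasFiniteSupport_of_abs (N := N + 1) fun i hi => ?_
  rcases abs_cases i with ⟨h, -⟩ | ⟨h, -⟩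
  · simp only [hN i (by omega), hN (i + 1) (by omega), edgeClass_self]
  · simp only [p.eq_of_nonpos _ i (by omega), p.eq_of_nonpos _ (i + 1) (by omega),
      edgeClass_self]

/-- The 1-chain of the chosen path. -/
noncomputable def pathClass (R : Type*) [CommRing R] (a : V) : CubeCokernel R G :=
  ∑ᶠ i, edgeClass R G (p a i) (p a (i + 1))

/-- Negative times traverse the path of a backwards, time 0 is the edge itself, and positive times
traverse the path of b with a delay of one. -/
theorem chainClass_bridge {a b : V} (h : WeakAdj G a b) :
    (p.bridge h).chainClass R = edgeClass R G a b + (p.pathClass R b - p.pathClass R a) := by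
  -- The step of the loop from i to i + 1, for negative i, is the reverse of the step of the path of
  -- a that starts at time -i - 1.
  let e : ℤ ≃ ℤ := (Equiv.neg ℤ).trans (Equiv.subRight 1)
  have he : ∀ i, e i = -i - 1 := fun _ => rfl
  have ha : (fun i => edgeClass R G (p a (e i)) (p a (e i + 1))).HasFiniteSupport :=
    .comp_of_injective (f := fun i => edgeClass R G (p a i) (p a (i + 1)))
      e.injective (p.hasFiniteSupport a)
  have hb : (fun i => edgeClass R G (p b (i - 1)) (p b (i - 1 + 1))).HasFiniteSupport :=
    .comp_of_injective (f := fun i => edgeClass R G (p b i) (p b (i + 1)))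
      (Equiv.subRight (1 : ℤ)).injective (p.hasFiniteSupport b)
  have hs : (fun i : ℤ => if i = 0 then edgeClass R G a b else 0).HasFiniteSupport :=
    (Set.finite_singleton (0 : ℤ)).subset fun i hi => by
      by_contra h'
      exact hi (if_neg h')
  have hsum : ∑ᶠ i : ℤ, (if i = 0 then edgeClass R G a b else 0) = edgeClass R G a b := by
    rw [finsum_eq_single _ 0 fun i hi => if_neg hi, if_pos rfl]
  rw [pathClass, pathClass, ← hsum,
    ← finsum_comp_sub (fun i => edgeClass R G (p b i) (p b (i + 1))) 1,
    ← finsum_comp_equiv e (f := fun i => edgeClass R G (p a i) (p a (i + 1))),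
    ← finsum_sub_distrib hb ha, ← finsum_add_distrib hs (hb.fun_sub ha), Loop.chainClass]
  refine finsum_congr fun i => ?_
  simp only [he, bridge_apply, sub_add_cancel]
  rcases lt_trichotomy i 0 with hi | rfl | hi
  · rw [if_pos hi.le, if_pos (by omega), if_neg hi.ne, p.eq_of_nonpos b _ (by omega),
      p.eq_of_nonpos b _ hi.le, edgeClass_self, zero_add, zero_sub,
      ← edgeClass_symm (p.weakAdj_of_close a (by omega) (by omega))]
    congr 2
    ring
  · simp [p.eq_of_nonpos, edgeClass_self]
  · rw [if_neg (by omega), if_neg (by omega), if_neg hi.ne', p.eq_of_nonpos a (-i - 1) (by omega),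
      p.eq_of_nonpos a (-i) (by omega), edgeClass_self, zero_add, sub_zero, add_sub_cancel_right]

/-- Closing up an edge adds the path of its end and subtracts that of its start. This correction is
a linear function of the boundary and so disappears on cycles. -/
theorem hurewicz_weightHom (x : CubeCokernel R G) :
    hurewicz R G v₀ (p.weightHom R x) =
      x + pointLift G (p.pathClass R) (cokernelBoundary R G x) := by
  refine LinearMap.congr_fun (f := (hurewicz R G v₀).comp (p.weightHom R))
    (g := LinearMap.id + (pointLift G (p.pathClass R)).comp (cokernelBoundary R G))
    (cubeCokernel_hom_ext fun a b h => ?_) x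
  simp only [LinearMap.comp_apply, LinearMap.add_apply, LinearMap.id_apply,
    p.weightHom_edgeClass h, p.weight_of_weakAdj h, hurewicz_one_tmul, p.chainClass_bridge h,
    cokernelBoundary_edgeClass h, map_sub, pointLift_pointChain]

theorem range_hurewicz (p : PathSystem G v₀) :
    LinearMap.range (hurewicz R G v₀) = LinearMap.ker (cokernelBoundary R G) := by
  apply le_antisymm
  · rw [LinearMap.range_le_ker_iff]
    refine hurewicz_hom_ext fun f => ?_
    rw [LinearMap.comp_apply, hurewicz_one_tmul, cokernelBoundary_chainClass,
      LinearMap.zero_apply]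
  · intro x hx
    refine ⟨p.weightHom R x, ?_⟩
    rw [p.hurewicz_weightHom, LinearMap.mem_ker.1 hx, map_zero, add_zero]

end PathSystem

/-! ### Homology as the kernel of the boundary on the cokernel. -/

/-- The inclusion of the homology into the cokernel. -/
noncomputable def homologyToCokernel (R : Type*) [CommRing R] (G : SimpleGraph V) :
    CubeHomology R G 1 →ₗ[R] CubeCokernel R G :=
  Submodule.mapQ _ _ (cubeCycles R G 1).subtype (by rw [Submodule.submoduleOf])

theorem homologyToCokernel_injective : Function.Injective (homologyToCokernel R G) := by
  rw [← LinearMap.ker_eq_bot, LinearMap.ker_eq_bot']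
  intro x hx
  obtain ⟨x, rfl⟩ := Submodule.Quotient.mk_surjective _ x
  rw [homologyToCokernel, Submodule.mapQ_apply, Submodule.Quotient.mk_eq_zero] at hx
  exact (Submodule.Quotient.mk_eq_zero _).2 hx

theorem range_homologyToCokernel :
    LinearMap.range (homologyToCokernel R G) = LinearMap.ker (cokernelBoundary R G) := by
  ext y
  obtain ⟨y, rfl⟩ := Submodule.Quotient.mk_surjective _ y
  rw [LinearMap.mem_ker, cokernelBoundary, Submodule.liftQ_apply]
  constructor
  · rintro ⟨x, hx⟩
    obtain ⟨⟨x, hx'⟩, rfl⟩ := Submodule.Quotient.mk_surjective _ x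
    rw [homologyToCokernel, Submodule.mapQ_apply] at hx
    have := congrArg (cokernelBoundary R G) hx
    rw [cokernelBoundary, Submodule.liftQ_apply, Submodule.liftQ_apply] at this
    exact this.symm.trans (LinearMap.mem_ker.1 hx')
  · intro hy
    exact ⟨Submodule.Quotient.mk ⟨y, hy⟩, rfl⟩

/-- Homology and the tensor product both embed in the cokernel with the same image, the kernel of
the boundary. The cokernel is used because maps out of it are given on edges, while cycles have no
such generators. -/
theorem nonempty_cubeHomology_equiv_tensor (h : G.Connected) (v₀ : V) (R : Type*) [CommRing R] :
    Nonempty (CubeHomology R G 1 ≃ₗ[R] R ⊗[ℤ] Additive (Abelianization (A1 G v₀))) := by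
  obtain ⟨p⟩ := h.nonempty_pathSystem v₀
  exact ⟨(LinearEquiv.ofInjective _ homologyToCokernel_injective).trans
    ((LinearEquiv.ofEq _ _ (range_homologyToCokernel.trans p.range_hurewicz.symm)).trans
      (LinearEquiv.ofInjective _ (Function.LeftInverse.injective p.weightHom_hurewicz)).symm)⟩

end Hurewicz
end DiscreteHomology

theorem mainTheorem11 {V : Type*} (G : SimpleGraph V) (R : Type*) [CommRing R] :
    Nonempty (DiscreteHomology.CubeHomology R G 1 ≃ₗ[R] DiscreteHomology.PathHomology R G 1) ∧
    (G.Connected → ∀ v₀ : V,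
      (Nonempty (DiscreteHomology.CubeHomology ℤ G 1 ≃+
          Additive (Abelianization (DiscreteHomology.A1 G v₀))) ∧
        Nonempty (Additive (Abelianization (DiscreteHomology.A1 G v₀)) ≃+
          DiscreteHomology.PathHomology ℤ G 1)) ∧
      (Nonempty (DiscreteHomology.CubeHomology R G 1 ≃ₗ[R]
          R ⊗[ℤ] Additive (Abelianization (DiscreteHomology.A1 G v₀))) ∧
        Nonempty (R ⊗[ℤ] Additive (Abelianization (DiscreteHomology.A1 G v₀)) ≃ₗ[R]
          DiscreteHomology.PathHomology R G 1))) := by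
  obtain ⟨e⟩ := DiscreteHomology.nonempty_cubeHomology_equiv_pathHomology R G
  obtain ⟨eZ⟩ := DiscreteHomology.nonempty_cubeHomology_equiv_pathHomology ℤ G
  refine ⟨⟨e⟩, fun h v₀ => ?_⟩
  obtain ⟨u⟩ := DiscreteHomology.nonempty_cubeHomology_equiv_tensor h v₀ R
  obtain ⟨uZ⟩ := DiscreteHomology.nonempty_cubeHomology_equiv_tensor h v₀ ℤ
  -- The integral case is R = ℤ, where the tensor factor drops out.
  let w := uZ.toAddEquiv.trans (TensorProduct.lid ℤ _).toAddEquiv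
  exact ⟨⟨⟨w⟩, ⟨w.symm.trans eZ.toAddEquiv⟩⟩, ⟨u⟩, ⟨u.symm.trans e⟩⟩
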